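/- \textbf{Model.} Let $Q\subseteq\mathbb R^d$, and let $D_1=(x^{(1)}_i)_{i\le n_1}$, $D_2=(x^{(2)}_j)_{j\le n_2}$ be finite designs in $Q$ with $D_2\subseteq D_1$. Let $f_1:Q\to\mathbb R^{p_1}$, $f_2:Q\to\mathbb R^{p_2}$ be regression functions and $r_t(\cdot\,;\theta_t)$, $t=1,2$, correlation functions with fixed $\theta=(\theta_1,\theta_2)$. Given parameters $\beta_1\in\mathbb R^{p_1}$, $\beta_2\in\mathbb R^{p_2}$, $\rho\in\mathbb R$, $\sigma_1^2,\sigma_2^2>0$, let $Z_2(x)=\rho Z_1(x)+\delta(x)$, $x \in Q$, where $Z_1$ and $\delta$ are independent Gaussian processes with means $f_1(x)^T\beta_1$, $f_2(x)^T\beta_2$ and covariances $\sigma_1^2 r_1(x-x';\theta_1)$, $\sigma_2^2r_2(x-x';\theta_2)$. Write $R_t(D,D')$ for the matrix with entries $r_t(x-x';\theta_t)$, $x\in D$, $x'\in D'$, and $R_t(D)=R_t(D,D)$; write $F_t(D)$ for the matrix with rows $f_t(x)^T$, $x\in D$. Let $z_1,z_2:Q\to\mathbb R$ be the two code outputs;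 the data are $z_1(D_1)$ and $z_2(D_2)$. Put $F_1=F_1(D_1)$, $R_1=R_1(D_1)$, $R_2=R_2(D_2)$, $F=[\,z_1(D_2)\ \ F_2(D_2)\,]$ and $\lambda=(\rho,\beta_2)\in\mathbb R^{1+p_2}$. \textbf{Priors.} $IG(\alpha,\gamma)$ has density $\frac{\gamma^\alpha}{\Gamma(\alpha)}\,e^{-\gamma/x}x^{-\alpha-1}\mathbf 1_{x>0}$. For each of the two levels, independently, one of two priors is chosen. (I) Informative: $\beta_1\mid\sigma_1^2\sim N(b_1,\sigma_1^2V_1)$ and $\sigma_1^2\sim IG(\alpha_1,\gamma_1)$, respectively $\lambda\mid z_1,\sigma_2^2\sim N(b_\lambda,\sigma_2^2V_\lambda)$ and $\sigma_2^2\mid z_1\sim IG(\alpha_2,\gamma_2)$, with $V_1,V_\lambda$ diagonal with positive diagonal entries and $\alpha_t,\gamma_t>0$. (II) Non-informative: the density of the regression coefficients given the variance is $\propto1$, and that of the variance is $\propto1/\sigma_t^2$ on $(0,\infty)$. The joint prior is the product $p(\beta_1|\sigma_1^2)\,p(\sigma_1^2)\,p(\lambda|z_1,\sigma_2^2)\,p(\sigma_2^2|z_1)$.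 Posterior densities are given by Bayes' formula (likelihood times prior, normalised to integral one). \textbf{Assumptions.} $R_1$ and $R_2$ are positive definite, $F_1$ and $F$ have full column rank, and, if prior (II) is used at level 1 (respectively level 2), $z_1(D_1)$ is not in the column space of $F_1$ (respectively $z_2(D_2)$ is not in the column space of $F$). \textbf{Claim.} (a) Given the parameters, $Z_1(D_1)$ has density $N(F_1\beta_1,\sigma_1^2R_1)$, and $(Z_1(D_1),Z_2(D_2))$ has density $N\big(H\binom{\beta_1}{\beta_2},V\big)$ with $$H=\begin{pmatrix}F_1(D_1)&0\\ \rho F_1(D_2)&F_2(D_2)\end{pmatrix},\quad V=\begin{pmatrix}\sigma_1^2R_1(D_1)&\rho\sigma_1^2R_1(D_1,D_2)\\ \rho\sigma_1^2R_1(D_2,D_1)&\rho^2\sigma_1^2R_1(D_2)+\sigma_2^2R_2(D_2)\end{pmatrix}.$$ With these likelihoods, the normalising integrals for the posterior of $(\beta_1,\sigma_1^2)$ given $z_1$ and for that of all the parameters given $(z_1,z_2)$ are finite and positive. (b) For all values of the parameters, $$p(\beta_1,\beta_2,\rho,\sigma_1^2,\sigma_2^2|z_1,z_2)=p(\beta_1|\sigma_1^2,z_1)\,p(\beta_2,\rho|\sigma_2^2,z_1,z_2)\,p(\sigma_1^2|z_1)\,p(\sigma_2^2|z_1,z_2),$$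 where the factors given $z_1$ are the conditional and marginal densities of the posterior of $(\beta_1,\sigma_1^2)$ given $z_1$, and those given $(z_1,z_2)$ are the conditional and marginal densities of the full posterior. (c) For all $\sigma_1^2,\sigma_2^2>0$ the factors are the densities of $$\beta_1|\sigma_1^2,z_1\sim N(A^1\nu^1,A^1),\quad(\rho,\beta_2)|\sigma_2^2,z_1,z_2\sim N(A^\lambda\nu^\lambda,A^\lambda),$$ $$\sigma_1^2|z_1\sim IG(a^1,\tfrac12Q^1),\quad\sigma_2^2|z_1,z_2\sim IG(a^2,\tfrac12Q^2).$$ With $\hat\beta_1=(F_1^TR_1^{-1}F_1)^{-1}F_1^TR_1^{-1}z_1(D_1)$ and $S_1=z_1(D_1)^T\big[R_1^{-1}-R_1^{-1}F_1(F_1^TR_1^{-1}F_1)^{-1}F_1^TR_1^{-1}\big]z_1(D_1)$, the level-1 quantities are, in case (I), $$A^1=\Big[F_1^T\tfrac{R_1^{-1}}{\sigma_1^2}F_1+\tfrac{V_1^{-1}}{\sigma_1^2}\Big]^{-1},\quad\nu^1=F_1^T\tfrac{R_1^{-1}}{\sigma_1^2}z_1(D_1)+\tfrac{V_1^{-1}}{\sigma_1^2}b_1,\quad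 a^1=\tfrac{n_1}2+\alpha_1,$$ $$Q^1=2\gamma_1+(b_1-\hat\beta_1)^T\big(V_1+[F_1^TR_1^{-1}F_1]^{-1}\big)^{-1}(b_1-\hat\beta_1)+S_1,$$ and, in case (II), $$A^1=\Big[F_1^T\tfrac{R_1^{-1}}{\sigma_1^2}F_1\Big]^{-1},\quad\nu^1=F_1^T\tfrac{R_1^{-1}}{\sigma_1^2}z_1(D_1),\quad a^1=\tfrac{n_1-p_1}2,\quad Q^1=S_1.$$ The level-2 quantities $A^\lambda,\nu^\lambda,a^2,Q^2$ are given by the same formulas with $(F_1,R_1,z_1(D_1),\sigma_1^2,b_1,V_1,\alpha_1,\gamma_1,n_1,p_1)$ replaced by $(F,R_2,z_2(D_2),\sigma_2^2,b_\lambda,V_\lambda,\alpha_2,\gamma_2,n_2,1+p_2)$. -/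

import Mathlib

open MeasureTheory ProbabilityTheory
open scoped Matrix

noncomputable section

/-! ### Gaussian and inverse-gamma densities -/

/-- Density, with respect to Lebesgue measure on `ι → ℝ`, of the multivariate normal distribution
with mean `m` and (positive definite) covariance matrix `S`. -/
def gaussianDensity {ι : Type*} [Fintype ι] [DecidableEq ι]
    (m : ι → ℝ) (S : Matrix ι ι ℝ) (x : ι → ℝ) : ℝ :=
  (Real.sqrt ((2 * Real.pi) ^ Fintype.card ι * S.det))⁻¹ *
    Real.exp (-((x - m) ⬝ᵥ (S⁻¹ *ᵥ (x - m))) / 2)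

/-- Density of the inverse-gamma distribution `IG(α, Q)`. -/
def invGammaDensity (α Q x : ℝ) : ℝ :=
  if 0 < x then Q ^ α / Real.Gamma α * (Real.exp (-(Q / x)) / x ^ (α + 1)) else 0

/-! ### Priors for one level: regression coefficients `b : κ → ℝ` given the variance `s`, and `s` -/

/-- The prior specification of one level.
* `informative α γ b v`: coefficients given `s` are `N(b, s • diag v)` and `s` is `IG(α, γ)`.
* `jeffreys c c'`: the improper prior with `p(coefficients | s) = c` and `p(s) = c' / s`;
  the positive constants stand for the arbitrary proportionality factors. -/
inductive LevelPrior (κ : Type*) where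
  | informative (α γ : ℝ) (b v : κ → ℝ)
  | jeffreys (c c' : ℝ)

namespace LevelPrior

variable {ι κ : Type*} [Fintype ι] [DecidableEq ι] [Fintype κ] [DecidableEq κ]

/-- The hyper-parameters are in their admissible range. -/
def Valid : LevelPrior κ → Prop
  | informative α γ _ v => 0 < α ∧ 0 < γ ∧ ∀ k, 0 < v k
  | jeffreys c c' => 0 < c ∧ 0 < c'

/-- The prior is the non-informative one. -/
def IsJeffreys : LevelPrior κ → Prop
  | informative _ _ _ _ => False
  | jeffreys _ _ => True

/-- Prior density of the regression coefficients given the variance `s`. -/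
def coefDensity (π : LevelPrior κ) (s : ℝ) (β : κ → ℝ) : ℝ :=
  match π with
  | informative _ _ b v => gaussianDensity b (s • Matrix.diagonal v) β
  | jeffreys c _ => c

/-- Prior density of the variance `s`; it vanishes for `s ≤ 0`. -/
def varDensity (π : LevelPrior κ) (s : ℝ) : ℝ :=
  match π with
  | informative α γ _ _ => invGammaDensity α γ s
  | jeffreys _ c' => if 0 < s then c' / s else 0

/-- Generalised least squares estimator `(Fᵀ R⁻¹ F)⁻¹ Fᵀ R⁻¹ y`. -/
def gls (F : Matrix ι κ ℝ) (R : Matrix ι ι ℝ) (y : ι → ℝ) : κ → ℝ :=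
  (Fᵀ * R⁻¹ * F)⁻¹ *ᵥ ((Fᵀ * R⁻¹) *ᵥ y)

/-- Generalised residual sum of squares `yᵀ (R⁻¹ - R⁻¹ F (Fᵀ R⁻¹ F)⁻¹ Fᵀ R⁻¹) y`. -/
def residual (F : Matrix ι κ ℝ) (R : Matrix ι ι ℝ) (y : ι → ℝ) : ℝ :=
  y ⬝ᵥ ((R⁻¹ - R⁻¹ * F * (Fᵀ * R⁻¹ * F)⁻¹ * Fᵀ * R⁻¹) *ᵥ y)

/-- The matrix `A`: covariance of the coefficients given `s` and the data. -/
def postCov (π : LevelPrior κ) (F : Matrix ι κ ℝ) (R : Matrix ι ι ℝ) (s : ℝ) : Matrix κ κ ℝ :=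
  match π with
  | informative _ _ _ v => (Fᵀ * (s⁻¹ • R⁻¹) * F + s⁻¹ • (Matrix.diagonal v)⁻¹)⁻¹
  | jeffreys _ _ => (Fᵀ * (s⁻¹ • R⁻¹) * F)⁻¹

/-- The vector `ν`; the mean of the coefficients given `s` and the data is `A ν`. -/
def postVec (π : LevelPrior κ) (F : Matrix ι κ ℝ) (R : Matrix ι ι ℝ) (y : ι → ℝ) (s : ℝ) : κ → ℝ :=
  match π with
  | informative _ _ b v => (Fᵀ * (s⁻¹ • R⁻¹)) *ᵥ y + (s⁻¹ • (Matrix.diagonal v)⁻¹) *ᵥ b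
  | jeffreys _ _ => (Fᵀ * (s⁻¹ • R⁻¹)) *ᵥ y

/-- The shape parameter of the posterior of the variance, for `card ι` observations. -/
def postShape (π : LevelPrior κ) (ι : Type*) [Fintype ι] : ℝ :=
  match π with
  | informative α _ _ _ => (Fintype.card ι : ℝ) / 2 + α
  | jeffreys _ _ => ((Fintype.card ι : ℝ) - (Fintype.card κ : ℝ)) / 2

/-- The number `Q`; the scale parameter of the posterior of the variance is `Q / 2`. -/
def postQ (π : LevelPrior κ) (F : Matrix ι κ ℝ) (R : Matrix ι ι ℝ) (y : ι → ℝ) : ℝ :=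
  match π with
  | informative _ γ b v =>
      2 * γ + (b - gls F R y) ⬝ᵥ
        ((Matrix.diagonal v + (Fᵀ * R⁻¹ * F)⁻¹)⁻¹ *ᵥ (b - gls F R y)) + residual F R y
  | jeffreys _ _ => residual F R y

end LevelPrior

/-! ### The two-level autoregressive model -/

/-- Fixed ingredients of the two-level model on an input space `Q ⊆ ℝ^d`: nested designs, regression
functions, and correlation functions `r_t(x - x'; θ_t)`. -/
structure TwoLevelModel (d n₁ n₂ p₁ p₂ : ℕ) (Θ₁ Θ₂ : Type*) where
  Q : Set (EuclideanSpace ℝ (Fin d))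
  D₁ : Fin n₁ → Q
  D₂ : Fin n₂ → Q
  nested : Set.range D₂ ⊆ Set.range D₁
  f₁ : Q → Fin p₁ → ℝ
  f₂ : Q → Fin p₂ → ℝ
  r₁ : EuclideanSpace ℝ (Fin d) → Θ₁ → ℝ
  r₂ : EuclideanSpace ℝ (Fin d) → Θ₂ → ℝ

/-- The vector `(ρ, β₂)`. -/
def lamVec {p : ℕ} (ρ : ℝ) (β₂ : Fin p → ℝ) : Unit ⊕ Fin p → ℝ :=
  Sum.elim (fun _ => ρ) β₂

/-- Under `P` the process `Z` is Gaussian with mean function `m` and covariance function `c`. -/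
structure IsGaussianProcessWith {T Ω : Type*} [MeasurableSpace Ω] (Z : T → Ω → ℝ) (P : Measure Ω)
    (m : T → ℝ) (c : T → T → ℝ) : Prop where
  gaussian : IsGaussianProcess Z P
  mean : ∀ x, ∫ ω, Z x ω ∂P = m x
  covariance : ∀ x y, cov[Z x, Z y; P] = c x y

namespace TwoLevelModel

variable {d n₁ n₂ p₁ p₂ : ℕ} {Θ₁ Θ₂ : Type*} (M : TwoLevelModel d n₁ n₂ p₁ p₂ Θ₁ Θ₂)

/-- `R₁(D, D')` -/
def R₁ (θ₁ : Θ₁) {m k : ℕ} (D : Fin m → M.Q) (D' : Fin k → M.Q) : Matrix (Fin m) (Fin k) ℝ :=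
  Matrix.of fun i j => M.r₁ ((D i : EuclideanSpace ℝ (Fin d)) - D' j) θ₁

/-- `R₂(D, D')` -/
def R₂ (θ₂ : Θ₂) {m k : ℕ} (D : Fin m → M.Q) (D' : Fin k → M.Q) : Matrix (Fin m) (Fin k) ℝ :=
  Matrix.of fun i j => M.r₂ ((D i : EuclideanSpace ℝ (Fin d)) - D' j) θ₂

/-- `F₁(D)`, with rows `f₁(x)ᵀ` -/
def F₁ {m : ℕ} (D : Fin m → M.Q) : Matrix (Fin m) (Fin p₁) ℝ := Matrix.of fun i => M.f₁ (D i)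

/-- `F₂(D)`, with rows `f₂(x)ᵀ` -/
def F₂ {m : ℕ} (D : Fin m → M.Q) : Matrix (Fin m) (Fin p₂) ℝ := Matrix.of fun i => M.f₂ (D i)

/-- The design matrix `F = [z₁(D₂)  F₂(D₂)]` of the second level. -/
def F (z₁ : M.Q → ℝ) : Matrix (Fin n₂) (Unit ⊕ Fin p₂) ℝ :=
  Matrix.of fun j => lamVec (z₁ (M.D₂ j)) (M.f₂ (M.D₂ j))

/-- The matrix `H` (it depends on `ρ`). -/
def H (ρ : ℝ) : Matrix (Fin n₁ ⊕ Fin n₂) (Fin p₁ ⊕ Fin p₂) ℝ :=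
  Matrix.fromBlocks (M.F₁ M.D₁) 0 (ρ • M.F₁ M.D₂) (M.F₂ M.D₂)

/-- The covariance matrix `V` of the observations, where `s_t` stands for `σ_t²`. -/
def V (θ₁ : Θ₁) (θ₂ : Θ₂) (ρ s₁ s₂ : ℝ) : Matrix (Fin n₁ ⊕ Fin n₂) (Fin n₁ ⊕ Fin n₂) ℝ :=
  Matrix.fromBlocks (s₁ • M.R₁ θ₁ M.D₁ M.D₁) ((ρ * s₁) • M.R₁ θ₁ M.D₁ M.D₂)
    ((ρ * s₁) • M.R₁ θ₁ M.D₂ M.D₁)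
    ((ρ ^ 2 * s₁) • M.R₁ θ₁ M.D₂ M.D₂ + s₂ • M.R₂ θ₂ M.D₂ M.D₂)

/-- The autoregressive model given the parameters: under `P`, `Z₁` and `δ` are independent Gaussian
processes with the prescribed means and covariances, and `Z₂ = ρ Z₁ + δ`. -/
structure IsAutoregressive (θ₁ : Θ₁) (θ₂ : Θ₂) (β₁ : Fin p₁ → ℝ) (β₂ : Fin p₂ → ℝ) (ρ s₁ s₂ : ℝ)
    {Ω : Type*} [MeasurableSpace Ω] (P : Measure Ω) (Z₁ Z₂ δ : M.Q → Ω → ℝ) : Prop where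
  level₁ : IsGaussianProcessWith Z₁ P (fun x => M.f₁ x ⬝ᵥ β₁)
    (fun x y => s₁ * M.r₁ ((x : EuclideanSpace ℝ (Fin d)) - y) θ₁)
  discrepancy : IsGaussianProcessWith δ P (fun x => M.f₂ x ⬝ᵥ β₂)
    (fun x y => s₂ * M.r₂ ((x : EuclideanSpace ℝ (Fin d)) - y) θ₂)
  indep : IndepFun (fun ω x => Z₁ x ω) (fun ω x => δ x ω) P
  autoregression : ∀ x ω, Z₂ x ω = ρ * Z₁ x ω + δ x ω

/-- The likelihood `p(y₁ | β₁, σ₁², θ₁)` of the first-level observations. -/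
def likelihood₁ (θ₁ : Θ₁) (β₁ : Fin p₁ → ℝ) (s₁ : ℝ) (y₁ : Fin n₁ → ℝ) : ℝ :=
  gaussianDensity (M.F₁ M.D₁ *ᵥ β₁) (s₁ • M.R₁ θ₁ M.D₁ M.D₁) y₁

/-- The likelihood `p(y₁, y₂ | β₁, β₂, ρ, σ₁², σ₂², θ)` of all the observations: the density of
`N(H β, V)`. -/
def likelihood (θ₁ : Θ₁) (θ₂ : Θ₂) (β₁ : Fin p₁ → ℝ) (β₂ : Fin p₂ → ℝ) (ρ s₁ s₂ : ℝ)
    (y : Fin n₁ ⊕ Fin n₂ → ℝ) : ℝ :=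
  gaussianDensity (M.H ρ *ᵥ Sum.elim β₁ β₂) (M.V θ₁ θ₂ ρ s₁ s₂) y

/-- The code outputs at the design points. -/
def obs (z₁ z₂ : M.Q → ℝ) : Fin n₁ ⊕ Fin n₂ → ℝ := Sum.elim (z₁ ∘ M.D₁) (z₂ ∘ M.D₂)

/-! #### First level: posterior of `(β₁, σ₁²)` given `z₁` -/

section Level₁

variable (θ₁ : Θ₁) (π₁ : LevelPrior (Fin p₁)) (z₁ : M.Q → ℝ)

/-- likelihood times prior -/
def joint₁ (q : (Fin p₁ → ℝ) × ℝ) : ℝ :=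
  M.likelihood₁ θ₁ q.1 q.2 (z₁ ∘ M.D₁) * (π₁.coefDensity q.2 q.1 * π₁.varDensity q.2)

/-- `p(β₁, σ₁² | z₁)`, by Bayes' formula -/
def post₁ (β₁ : Fin p₁ → ℝ) (s₁ : ℝ) : ℝ := M.joint₁ θ₁ π₁ z₁ (β₁, s₁) / ∫ q, M.joint₁ θ₁ π₁ z₁ q

/-- `p(σ₁² | z₁)` -/
def postVar₁ (s₁ : ℝ) : ℝ := ∫ β₁, M.post₁ θ₁ π₁ z₁ β₁ s₁

/-- `p(β₁ | σ₁², z₁)` -/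
def postCoef₁ (s₁ : ℝ) (β₁ : Fin p₁ → ℝ) : ℝ := M.post₁ θ₁ π₁ z₁ β₁ s₁ / M.postVar₁ θ₁ π₁ z₁ s₁

end Level₁

/-! #### Posterior of all the parameters given `z₁` and `z₂`

The parameters are ordered as `(β₁, (ρ, β₂), σ₁², σ₂²)`. -/

section Full

variable (θ₁ : Θ₁) (θ₂ : Θ₂) (π₁ : LevelPrior (Fin p₁)) (π₂ : LevelPrior (Unit ⊕ Fin p₂))
  (z₁ z₂ : M.Q → ℝ)

/-- likelihood times hierarchical prior `p(β₁|σ₁²) p(σ₁²) p(ρ,β₂|z₁,σ₂²) p(σ₂²|z₁)` -/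
def joint (q : (Fin p₁ → ℝ) × (Unit ⊕ Fin p₂ → ℝ) × ℝ × ℝ) : ℝ :=
  M.likelihood θ₁ θ₂ q.1 (q.2.1 ∘ Sum.inr) (q.2.1 (Sum.inl ())) q.2.2.1 q.2.2.2 (M.obs z₁ z₂) *
    ((π₁.coefDensity q.2.2.1 q.1 * π₁.varDensity q.2.2.1) *
      (π₂.coefDensity q.2.2.2 q.2.1 * π₂.varDensity q.2.2.2))

/-- `p(β₁, ρ, β₂, σ₁², σ₂² | z₁, z₂)`, by Bayes' formula -/
def post (β₁ : Fin p₁ → ℝ) (lam : Unit ⊕ Fin p₂ → ℝ) (s₁ s₂ : ℝ) : ℝ :=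
  M.joint θ₁ θ₂ π₁ π₂ z₁ z₂ (β₁, lam, s₁, s₂) / ∫ q, M.joint θ₁ θ₂ π₁ π₂ z₁ z₂ q

/-- `p(ρ, β₂, σ₂² | z₁, z₂)`, a marginal of the full posterior -/
def post₂ (lam : Unit ⊕ Fin p₂ → ℝ) (s₂ : ℝ) : ℝ :=
  ∫ q : (Fin p₁ → ℝ) × ℝ, M.post θ₁ θ₂ π₁ π₂ z₁ z₂ q.1 lam q.2 s₂

/-- `p(σ₂² | z₁, z₂)` -/
def postVar₂ (s₂ : ℝ) : ℝ := ∫ lam, M.post₂ θ₁ θ₂ π₁ π₂ z₁ z₂ lam s₂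

/-- `p(ρ, β₂ | σ₂², z₁, z₂)` -/
def postCoef₂ (s₂ : ℝ) (lam : Unit ⊕ Fin p₂ → ℝ) : ℝ :=
  M.post₂ θ₁ θ₂ π₁ π₂ z₁ z₂ lam s₂ / M.postVar₂ θ₁ θ₂ π₁ π₂ z₁ z₂ s₂

end Full

end TwoLevelModel

end

/-! The theorem is conjugacy applied twice, once the likelihood splits along the levels. Since `D₂`
is nested in `D₁`, the data are the image of (`Z₁(D₁)`, `δ(D₂)`) under a block unipotent matrix,
`mixing ρ`. Its determinant is one, so undoing it costs no Jacobian and turns `V` into a block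
diagonal matrix. The likelihood becomes p(z₁) p(z₂ | z₁), where the second factor is a linear
regression of `z₂(D₂)` on `F = [z₁(D₂) F₂(D₂)]`: `ρ` is just one more regression coefficient
(`likelihood_eq_mul`).

At each level, completing the square in the coefficients, first around the generalised least squares
estimator and then jointly with the prior, shows that likelihood times prior is a positive constant
times a normal-inverse-gamma density (`exists_likelihood_mul_prior_eq`). That density has integral
one, and its variance marginal is inverse-gamma. Hence the normalising integrals are the constants
themselves, the full posterior is a product of two normal-inverse-gamma densities, and all marginals
and conditionals can be read off.

The likelihoods are indeed densities of the observations because a Gaussian vector with positive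
definite covariance can be whitened to independent standard normals
(`HasGaussianLaw.map_eq_withDensity`). -/

noncomputable section

/-! ### The inverse-gamma density -/

lemma invGammaDensity_of_pos {a Q x : ℝ} (hx : 0 < x) :
    invGammaDensity a Q x = Q ^ a / Real.Gamma a * (Real.exp (-(Q / x)) / x ^ (a + 1)) :=
  if_pos hx

lemma invGammaDensity_of_nonpos {a Q x : ℝ} (hx : x ≤ 0) : invGammaDensity a Q x = 0 :=
  if_neg hx.not_gt

lemma invGammaDensity_pos {a Q x : ℝ} (ha : 0 < a) (hQ : 0 < Q) (hx : 0 < x) :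
    0 < invGammaDensity a Q x := by
  rw [invGammaDensity_of_pos hx]
  have := Real.Gamma_pos_of_pos ha
  positivity

lemma measurable_invGammaDensity (a Q : ℝ) : Measurable (invGammaDensity a Q) :=
  Measurable.ite measurableSet_Ioi (by fun_prop) measurable_const

/-- The substitution y = x⁻¹, with its Jacobian |-1| x⁻², in the shape expected by
`integral_comp_rpow_Ioi`; it reduces the inverse-gamma integral to Euler's Gamma integral. -/
lemma invGammaDensity_eq_comp_rpow {a Q x : ℝ} (hx : 0 < x) :
    invGammaDensity a Q x = Q ^ a / Real.Gamma a *
      ((|(-1 : ℝ)| * x ^ ((-1 : ℝ) - 1)) •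
        ((x ^ (-1 : ℝ)) ^ (a - 1) * Real.exp (-(Q * x ^ (-1 : ℝ))))) := by
  rw [invGammaDensity_of_pos hx, ← Real.rpow_mul hx.le, smul_eq_mul, abs_neg, abs_one, one_mul,
    ← mul_assoc (x ^ _), ← Real.rpow_add hx, Real.rpow_neg_one, ← div_eq_mul_inv,
    show (-1 : ℝ) - 1 + -1 * (a - 1) = -(a + 1) by ring, Real.rpow_neg hx.le]
  ring

lemma invGammaDensity_eq_indicator (a Q : ℝ) :
    invGammaDensity a Q = (Set.Ioi 0).indicator (invGammaDensity a Q) := by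
  ext x
  by_cases hx : 0 < x
  · rw [Set.indicator_of_mem (Set.mem_Ioi.2 hx)]
  · rw [Set.indicator_of_notMem (by simpa using hx), invGammaDensity_of_nonpos (not_lt.1 hx)]

lemma integrable_invGammaDensity {a Q : ℝ} (ha : 0 < a) (hQ : 0 < Q) :
    Integrable (invGammaDensity a Q) := by
  rw [invGammaDensity_eq_indicator, integrable_indicator_iff measurableSet_Ioi]
  refine IntegrableOn.congr_fun (Integrable.const_mul ?_ _)
    (fun x hx => (invGammaDensity_eq_comp_rpow (Set.mem_Ioi.1 hx)).symm) measurableSet_Ioi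
  refine (integrableOn_Ioi_comp_rpow_iff
    (fun y : ℝ => y ^ (a - 1) * Real.exp (-(Q * y))) (by norm_num : (-1 : ℝ) ≠ 0)).2 ?_
  simpa using integrableOn_rpow_mul_exp_neg_mul_rpow (s := a - 1) (by linarith) one_pos hQ

lemma integral_invGammaDensity {a Q : ℝ} (ha : 0 < a) (hQ : 0 < Q) :
    ∫ x, invGammaDensity a Q x = 1 := by
  rw [invGammaDensity_eq_indicator, integral_indicator measurableSet_Ioi,
    setIntegral_congr_fun measurableSet_Ioi
      (fun x hx => invGammaDensity_eq_comp_rpow (Set.mem_Ioi.1 hx)), integral_const_mul,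
    integral_comp_rpow_Ioi (fun y : ℝ => y ^ (a - 1) * Real.exp (-(Q * y)))
      (by norm_num : (-1 : ℝ) ≠ 0), Real.integral_rpow_mul_exp_neg_mul_Ioi ha hQ, one_div,
    Real.inv_rpow hQ.le]
  have := (Real.Gamma_pos_of_pos ha).ne'
  have := (Real.rpow_pos_of_pos hQ a).ne'
  field_simp

/-! ### The multivariate normal density -/

section Gaussian

variable {ι : Type*} [Fintype ι] [DecidableEq ι]

lemma gaussianDensity_nonneg (m : ι → ℝ) (S : Matrix ι ι ℝ) (x : ι → ℝ) :
    0 ≤ gaussianDensity m S x := by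
  unfold gaussianDensity
  positivity

lemma continuous_gaussianDensity (m : ι → ℝ) (S : Matrix ι ι ℝ) :
    Continuous (gaussianDensity m S) := by
  unfold gaussianDensity
  fun_prop

/-- An invertible affine change of variables leaves the quadratic form unchanged and multiplies the
determinant by `B.det ^ 2`. It serves twice: with `B` a square root of a covariance matrix, and with
`B` the unipotent mixing matrix. -/
lemma gaussianDensity_conj {B : Matrix ι ι ℝ} (hB : B.det ≠ 0) (S : Matrix ι ι ℝ)
    (a m x : ι → ℝ) :
    gaussianDensity (a + B *ᵥ m) (B * S * Bᵀ) (a + B *ᵥ x) =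
      |B.det|⁻¹ * gaussianDensity m S x := by
  have hBu : IsUnit B.det := hB.isUnit
  have hq : (a + B *ᵥ x - (a + B *ᵥ m)) ⬝ᵥ
      ((B * S * Bᵀ)⁻¹ *ᵥ (a + B *ᵥ x - (a + B *ᵥ m))) = (x - m) ⬝ᵥ (S⁻¹ *ᵥ (x - m)) := by
    rw [add_sub_add_left_eq_sub, ← Matrix.mulVec_sub, Matrix.mul_inv_rev, Matrix.mul_inv_rev,
      Matrix.mulVec_mulVec, Matrix.mul_assoc, Matrix.mul_assoc, Matrix.nonsing_inv_mul _ hBu,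
      Matrix.mul_one, ← Matrix.mulVec_mulVec, ← Matrix.transpose_nonsing_inv,
      Matrix.dotProduct_mulVec, Matrix.vecMul_transpose, Matrix.mulVec_mulVec,
      Matrix.nonsing_inv_mul _ hBu, Matrix.one_mulVec]
  unfold gaussianDensity
  rw [hq, Matrix.det_mul, Matrix.det_mul, Matrix.det_transpose,
    show (2 * Real.pi) ^ Fintype.card ι * (B.det * S.det * B.det) =
      B.det ^ 2 * ((2 * Real.pi) ^ Fintype.card ι * S.det) by ring,
    Real.sqrt_mul (sq_nonneg _), Real.sqrt_sq_eq_abs, mul_inv, mul_assoc]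

lemma Matrix.inv_smul_of_ne_zero {s : ℝ} (hs : s ≠ 0) {S : Matrix ι ι ℝ} (hS : IsUnit S.det) :
    (s • S)⁻¹ = s⁻¹ • S⁻¹ := by
  apply Matrix.inv_eq_right_inv
  rw [Matrix.smul_mul, Matrix.mul_smul, smul_smul, mul_inv_cancel₀ hs, one_smul,
    Matrix.mul_nonsing_inv _ hS]

/-- Makes the dependence on the variance explicit. The power of `s` is a real power so that it can
merge with those of the inverse-gamma density. -/
lemma gaussianDensity_smul {s : ℝ} (hs : 0 < s) {S : Matrix ι ι ℝ} (hS : 0 < S.det)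
    (m x : ι → ℝ) :
    gaussianDensity m (s • S) x =
      (Real.sqrt ((2 * Real.pi) ^ Fintype.card ι * S.det))⁻¹ *
        (s ^ ((Fintype.card ι : ℝ) / 2))⁻¹ *
        Real.exp (-((x - m) ⬝ᵥ (S⁻¹ *ᵥ (x - m)) / 2 / s)) := by
  unfold gaussianDensity
  rw [Matrix.inv_smul_of_ne_zero hs.ne' hS.ne'.isUnit, Matrix.smul_mulVec, dotProduct_smul, Matrix.det_smul,
    show (2 * Real.pi) ^ Fintype.card ι * (s ^ Fintype.card ι * S.det) =
      (2 * Real.pi) ^ Fintype.card ι * S.det * s ^ Fintype.card ι by ring,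
    Real.sqrt_mul (by positivity), mul_inv, Real.sqrt_eq_rpow (s ^ _), ← Real.rpow_natCast s,
    ← Real.rpow_mul hs.le, smul_eq_mul, mul_one_div]
  congr 2
  field_simp

lemma gaussianDensity_fromBlocks {κ : Type*} [Fintype κ] [DecidableEq κ]
    {A : Matrix ι ι ℝ} {D : Matrix κ κ ℝ} (hA : 0 < A.det) (hD : 0 < D.det)
    (m x : ι → ℝ) (n y : κ → ℝ) :
    gaussianDensity (Sum.elim m n) (Matrix.fromBlocks A 0 0 D) (Sum.elim x y) =
      gaussianDensity m A x * gaussianDensity n D y := by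
  have hinv : (Matrix.fromBlocks A 0 0 D)⁻¹ = Matrix.fromBlocks A⁻¹ 0 0 D⁻¹ := by
    apply Matrix.inv_eq_right_inv
    simp [Matrix.fromBlocks_multiply, Matrix.mul_nonsing_inv _ hA.ne'.isUnit,
      Matrix.mul_nonsing_inv _ hD.ne'.isUnit]
  have hsub : Sum.elim x y - Sum.elim m n = Sum.elim (x - m) (y - n) := by
    ext (i | i) <;> simp
  unfold gaussianDensity
  rw [hinv, hsub, Matrix.fromBlocks_mulVec]
  simp only [Sum.elim_comp_inl, Sum.elim_comp_inr, Matrix.zero_mulVec, add_zero, zero_add,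
    sumElim_dotProduct_sumElim, Matrix.det_fromBlocks_zero₂₁, Fintype.card_sum]
  rw [show (2 * Real.pi) ^ (Fintype.card ι + Fintype.card κ) * (A.det * D.det) =
      ((2 * Real.pi) ^ Fintype.card ι * A.det) * ((2 * Real.pi) ^ Fintype.card κ * D.det) by
      ring, Real.sqrt_mul (by positivity), mul_inv, neg_add, add_div, Real.exp_add]
  ring

lemma gaussianDensity_zero_one (x : ι → ℝ) :
    gaussianDensity 0 1 x = ∏ i, gaussianPDFReal 0 1 (x i) := by
  simp only [gaussianPDFReal, Finset.prod_mul_distrib, ← Real.exp_sum, Finset.prod_const,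
    gaussianDensity, Finset.card_univ]
  congr 1
  · rw [inv_pow, Matrix.det_one, mul_one, NNReal.coe_one, mul_one, Real.sqrt_eq_rpow,
      Real.sqrt_eq_rpow, ← Real.rpow_natCast, ← Real.rpow_natCast, ← Real.rpow_mul (by positivity),
      ← Real.rpow_mul (by positivity), mul_comm (1 / 2 : ℝ)]
  · simp [dotProduct, neg_div, Finset.sum_div, sq]

/-- A product measure is determined by its values on boxes; there the integrand is a product of
one-variable functions and Fubini applies. -/
lemma pi_gaussianReal_eq_withDensity :
    Measure.pi (fun _ : ι => gaussianReal 0 1) =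
      volume.withDensity (fun x => ENNReal.ofReal (gaussianDensity (0 : ι → ℝ) 1 x)) := by
  refine Measure.pi_eq fun s hs => ?_
  have hs' : MeasurableSet (Set.univ.pi s) := MeasurableSet.univ_pi hs
  have hind : ∀ x : ι → ℝ, (Set.univ.pi s).indicator (gaussianDensity 0 1) x =
      ∏ i, (s i).indicator (gaussianPDFReal 0 1) (x i) := by
    intro x
    by_cases hx : x ∈ Set.univ.pi s
    · rw [Set.indicator_of_mem hx, gaussianDensity_zero_one]
      exact Finset.prod_congr rfl fun i _ =>
        (Set.indicator_of_mem (hx i (Set.mem_univ i)) _).symm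
    · rw [Set.indicator_of_notMem hx]
      simp only [Set.mem_univ_pi, not_forall] at hx
      obtain ⟨i, hi⟩ := hx
      exact (Finset.prod_eq_zero (Finset.mem_univ i) (Set.indicator_of_notMem hi _)).symm
  have hint : Integrable (gaussianDensity (0 : ι → ℝ) 1) := by
    rw [show gaussianDensity (0 : ι → ℝ) 1 = fun x => ∏ i, gaussianPDFReal 0 1 (x i) from
      funext gaussianDensity_zero_one]
    exact Integrable.fintype_prod fun _ => integrable_gaussianPDFReal 0 1
  rw [withDensity_apply _ hs', ← ofReal_integral_eq_lintegral_ofReal hint.integrableOn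
    (Filter.Eventually.of_forall fun x => gaussianDensity_nonneg _ _ _),
    ← integral_indicator hs']
  simp_rw [hind]
  rw [volume_pi, integral_fintype_prod_eq_prod (μ := fun _ : ι => (volume : Measure ℝ))
      (f := fun i => (s i).indicator (gaussianPDFReal 0 1)),
    ENNReal.ofReal_prod_of_nonneg fun i _ => integral_nonneg
      (Set.indicator_nonneg fun x _ => gaussianPDFReal_nonneg 0 1 x)]
  refine Finset.prod_congr rfl fun i _ => ?_
  rw [integral_indicator (hs i), gaussianReal_apply_eq_integral _ one_ne_zero]

lemma map_pi_gaussianReal_eq_withDensity (m : ι → ℝ) {B : Matrix ι ι ℝ} (hB : B.det ≠ 0) :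
    (Measure.pi (fun _ : ι => gaussianReal 0 1)).map (fun x => m + B *ᵥ x) =
      volume.withDensity (fun x => ENNReal.ofReal (gaussianDensity m (B * Bᵀ) x)) := by
  have hmeas : ∀ (n : ι → ℝ) (S : Matrix ι ι ℝ),
      Measurable fun x => ENNReal.ofReal (gaussianDensity n S x) := fun n S =>
    (continuous_gaussianDensity n S).measurable.ennreal_ofReal
  have hlin : Measurable fun x : ι → ℝ => m + B *ᵥ x := by fun_prop
  rw [pi_gaussianReal_eq_withDensity]
  refine Measure.ext_of_lintegral _ fun f hf => ?_
  rw [lintegral_map hf hlin,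
    lintegral_withDensity_eq_lintegral_mul (g := fun x => f (m + B *ᵥ x)) _ (hmeas _ _)
      (hf.comp hlin),
    lintegral_withDensity_eq_lintegral_mul _ (hmeas _ _) hf]
  -- Lebesgue measure is translation invariant and is scaled by the determinant under a linear map;
  -- the factor |det B| cancels the one from `gaussianDensity_conj`.
  have hvol : (volume : Measure (ι → ℝ)) =
      ENNReal.ofReal |B.det| • Measure.map (Matrix.toLin' B) volume := by
    rw [Real.map_matrix_volume_pi_eq_smul_volume_pi hB, smul_smul,
      ← ENNReal.ofReal_mul (abs_nonneg _), ← abs_mul, mul_inv_cancel₀ hB]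
    simp
  have hlin' : Measurable (Matrix.toLin' B) :=
    (Matrix.toLin' B).continuous_of_finiteDimensional.measurable
  conv_rhs => rw [← lintegral_add_left_eq_self _ m, hvol]
  rw [lintegral_smul_measure, lintegral_map (by fun_prop) hlin', smul_eq_mul,
    ← lintegral_const_mul _ (by fun_prop)]
  refine lintegral_congr fun x => ?_
  have h := gaussianDensity_conj hB 1 m 0 x
  rw [Matrix.mulVec_zero, add_zero, Matrix.mul_one] at h
  simp only [Pi.mul_apply, Matrix.toLin'_apply]
  rw [h, ← mul_assoc, ← ENNReal.ofReal_mul (abs_nonneg _), ← mul_assoc,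
    mul_inv_cancel₀ (abs_ne_zero.2 hB), one_mul]

lemma Matrix.PosDef.exists_mul_transpose_eq {S : Matrix ι ι ℝ} (hS : S.PosDef) :
    ∃ B : Matrix ι ι ℝ, B.det ≠ 0 ∧ S = B * Bᵀ := by
  open scoped MatrixOrder in
  obtain ⟨y, hy⟩ := CStarAlgebra.nonneg_iff_eq_star_mul_self.mp hS.posSemidef.nonneg
  have hy' : S = yᵀ * yᵀᵀ := by
    rw [hy, Matrix.star_eq_conjTranspose, Matrix.conjTranspose_eq_transpose_of_trivial,
      Matrix.transpose_transpose]
  refine ⟨yᵀ, fun h => hS.det_pos.ne' ?_, hy'⟩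
  rw [hy', Matrix.det_mul, h, zero_mul]

lemma lintegral_gaussianDensity (m : ι → ℝ) {S : Matrix ι ι ℝ} (hS : S.PosDef) :
    ∫⁻ x, ENNReal.ofReal (gaussianDensity m S x) = 1 := by
  obtain ⟨B, hB, rfl⟩ := hS.exists_mul_transpose_eq
  rw [← setLIntegral_univ, ← withDensity_apply _ MeasurableSet.univ,
    ← map_pi_gaussianReal_eq_withDensity m hB, Measure.map_apply (by fun_prop) MeasurableSet.univ,
    Set.preimage_univ, measure_univ]

lemma integrable_gaussianDensity (m : ι → ℝ) {S : Matrix ι ι ℝ} (hS : S.PosDef) :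
    Integrable (gaussianDensity m S) := by
  refine (lintegral_ofReal_ne_top_iff_integrable
    (continuous_gaussianDensity m S).aestronglyMeasurable
    (Filter.Eventually.of_forall fun x => gaussianDensity_nonneg _ _ _)).1 ?_
  simp [lintegral_gaussianDensity m hS]

lemma integral_gaussianDensity (m : ι → ℝ) {S : Matrix ι ι ℝ} (hS : S.PosDef) :
    ∫ x, gaussianDensity m S x = 1 := by
  rw [integral_eq_lintegral_of_nonneg_ae
    (Filter.Eventually.of_forall fun x => gaussianDensity_nonneg _ _ _)
    (continuous_gaussianDensity m S).aestronglyMeasurable, lintegral_gaussianDensity m hS]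
  simp

/-- A Gaussian vector with nonsingular covariance matrix has the multivariate normal density. -/
lemma ProbabilityTheory.HasGaussianLaw.map_eq_withDensity {Ω : Type*} [MeasurableSpace Ω]
    {P : Measure Ω} {X : ι → Ω → ℝ} (hX : HasGaussianLaw (fun ω i => X i ω) P)
    {m : ι → ℝ} {S : Matrix ι ι ℝ} (hS : S.PosDef) (hm : ∀ i, ∫ ω, X i ω ∂P = m i)
    (hc : ∀ i j, cov[X i, X j; P] = S i j) :
    P.map (fun ω i => X i ω) =
      volume.withDensity (fun x => ENNReal.ofReal (gaussianDensity m S x)) := by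
  have := hX.isProbabilityMeasure
  obtain ⟨B, hB, rfl⟩ := hS.exists_mul_transpose_eq
  have hBu : IsUnit B.det := hB.isUnit
  have hXi : ∀ i, HasGaussianLaw (X i) P := fun i => hX.eval i
  have hL2 : ∀ i, MemLp (X i) 2 P := fun i => (hXi i).memLp_two
  -- Whitening: B⁻¹X has identity covariance, and uncorrelated jointly Gaussian coordinates are
  -- independent. After centring, the law is a product of standard normals, and X is recovered as an
  -- affine image.
  let L : (ι → ℝ) →L[ℝ] (ι → ℝ) := LinearMap.toContinuousLinearMap (Matrix.toLin' B⁻¹)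
  let Y : ι → Ω → ℝ := fun i ω => ∑ k, B⁻¹ i k * X k ω
  have hY : HasGaussianLaw (fun ω i => Y i ω) P := hX.map_fun L
  have hcov : ∀ i j, cov[Y i, Y j; P] = (1 : Matrix ι ι ℝ) i j := by
    intro i j
    have h1 : B⁻¹ * (B * Bᵀ) * B⁻¹ᵀ = 1 := by
      rw [← Matrix.mul_assoc, Matrix.nonsing_inv_mul _ hBu, Matrix.one_mul,
        ← Matrix.transpose_mul, Matrix.nonsing_inv_mul _ hBu, Matrix.transpose_one]
    rw [← h1, covariance_fun_sum_fun_sum (fun k => (hL2 k).const_mul _)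
      (fun k => (hL2 k).const_mul _)]
    simp_rw [covariance_const_mul_left, covariance_const_mul_right, hc]
    rw [Matrix.mul_apply, Finset.sum_comm]
    refine Finset.sum_congr rfl fun k _ => ?_
    rw [Matrix.mul_apply (M := B⁻¹), Finset.sum_mul]
    refine Finset.sum_congr rfl fun l _ => ?_
    rw [Matrix.transpose_apply]
    ring
  have hmean : ∀ i, ∫ ω, Y i ω ∂P = (B⁻¹ *ᵥ m) i := by
    intro i
    rw [integral_finsetSum _ fun k _ => ((hXi k).integrable).const_mul _]
    simp_rw [integral_const_mul, hm]
    rfl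
  have hind : iIndepFun Y P := hY.iIndepFun_of_covariance_eq_zero fun i j hij => by
    rw [hcov, Matrix.one_apply_ne hij]
  have hYi : ∀ i, HasGaussianLaw (Y i) P := fun i => hY.eval i
  have hlaw : ∀ i, P.map (fun ω => Y i ω - (B⁻¹ *ᵥ m) i) = gaussianReal 0 1 := by
    intro i
    have h2 := (hYi i).map_eq_gaussianReal
    rw [hmean i, ← covariance_self (hYi i).aemeasurable, hcov, Matrix.one_apply_eq] at h2
    have h3 := gaussianReal_map_sub_const (μ := (B⁻¹ *ᵥ m) i) (v := Real.toNNReal 1)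
      ((B⁻¹ *ᵥ m) i)
    rw [← h2, AEMeasurable.map_map_of_aemeasurable (by fun_prop) (hYi i).aemeasurable] at h3
    simpa [Function.comp_def] using h3
  have hind' : iIndepFun (fun i ω => Y i ω - (B⁻¹ *ᵥ m) i) P :=
    hind.comp (fun i y => y - (B⁻¹ *ᵥ m) i) fun i => by fun_prop
  have hmeas : ∀ i, AEMeasurable (fun ω => Y i ω - (B⁻¹ *ᵥ m) i) P := fun i =>
    (hYi i).aemeasurable.sub_const _
  have hpi := (iIndepFun_iff_map_fun_eq_pi_map hmeas).1 hind'
  simp_rw [hlaw] at hpi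
  rw [← map_pi_gaussianReal_eq_withDensity m hB, ← hpi,
    AEMeasurable.map_map_of_aemeasurable (by fun_prop) (aemeasurable_pi_lambda _ hmeas)]
  congr 1
  ext1 ω
  change _ = m + B *ᵥ (B⁻¹ *ᵥ (fun k => X k ω) - B⁻¹ *ᵥ m)
  rw [← Matrix.mulVec_sub, Matrix.mulVec_mulVec, Matrix.mul_nonsing_inv _ hBu, Matrix.one_mulVec,
    add_sub_cancel]

end Gaussian

/-! ### Completing the square -/

section Quadratic

variable {ι κ : Type*} [Fintype ι] [DecidableEq ι] [Fintype κ] [DecidableEq κ]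

omit [DecidableEq κ] in
lemma Matrix.IsSymm.dotProduct_mulVec_comm {M : Matrix κ κ ℝ} (hM : M.IsSymm) (x y : κ → ℝ) :
    x ⬝ᵥ (M *ᵥ y) = y ⬝ᵥ (M *ᵥ x) := by
  rw [dotProduct_comm, ← Matrix.vecMul_transpose, hM.eq, ← Matrix.dotProduct_mulVec]

omit [DecidableEq κ] in
lemma Matrix.IsSymm.dotProduct_mulVec_sub {M : Matrix κ κ ℝ} (hM : M.IsSymm) (x y : κ → ℝ) :
    (x - y) ⬝ᵥ (M *ᵥ (x - y)) = x ⬝ᵥ (M *ᵥ x) - 2 * (x ⬝ᵥ (M *ᵥ y)) + y ⬝ᵥ (M *ᵥ y) := by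
  rw [Matrix.mulVec_sub, sub_dotProduct, dotProduct_sub, dotProduct_sub,
    hM.dotProduct_mulVec_comm y x]
  ring

lemma Matrix.IsSymm.complete_square {M : Matrix κ κ ℝ} (hM : M.IsSymm) (hu : IsUnit M.det)
    (x c : κ → ℝ) :
    x ⬝ᵥ (M *ᵥ x) - 2 * (x ⬝ᵥ c) =
      (x - M⁻¹ *ᵥ c) ⬝ᵥ (M *ᵥ (x - M⁻¹ *ᵥ c)) - c ⬝ᵥ (M⁻¹ *ᵥ c) := by
  rw [hM.dotProduct_mulVec_sub, Matrix.mulVec_mulVec, Matrix.mul_nonsing_inv _ hu,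
    Matrix.one_mulVec, dotProduct_comm (M⁻¹ *ᵥ c)]
  ring

omit [Fintype κ] [DecidableEq κ] in
lemma Matrix.PosDef.isSymm {M : Matrix κ κ ℝ} (hM : M.PosDef) : M.IsSymm := by
  have := hM.isHermitian
  rwa [Matrix.IsHermitian, Matrix.conjTranspose_eq_transpose_of_trivial] at this

omit [DecidableEq κ] in
lemma posDef_transpose_mul_inv_mul {F : Matrix ι κ ℝ} {R : Matrix ι ι ℝ} (hR : R.PosDef)
    (hF : LinearIndependent ℝ F.col) : (Fᵀ * R⁻¹ * F).PosDef := by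
  rw [← Matrix.conjTranspose_eq_transpose_of_trivial]
  exact hR.inv.conjTranspose_mul_mul_same (Matrix.mulVec_injective_iff.2 hF)

namespace LevelPrior

/-- Pythagoras for the inner product defined by `R⁻¹`: `F *ᵥ gls F R y` is the orthogonal projection
of `y` onto the column space of `F`. In particular the residual is the squared distance from `y` to
that space, which gives its sign below. -/
lemma quadratic_eq_gls_add_residual {F : Matrix ι κ ℝ} {R : Matrix ι ι ℝ} (hR : R.PosDef)
    (hF : LinearIndependent ℝ F.col) (y : ι → ℝ) (β : κ → ℝ) :
    (y - F *ᵥ β) ⬝ᵥ (R⁻¹ *ᵥ (y - F *ᵥ β)) =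
      (β - gls F R y) ⬝ᵥ ((Fᵀ * R⁻¹ * F) *ᵥ (β - gls F R y)) + residual F R y := by
  have hG := posDef_transpose_mul_inv_mul hR hF
  have hW := hR.inv.isSymm
  have h := hG.isSymm.complete_square hG.det_pos.ne'.isUnit β ((Fᵀ * R⁻¹) *ᵥ y)
  have h1 : (F *ᵥ β) ⬝ᵥ (R⁻¹ *ᵥ y) = β ⬝ᵥ ((Fᵀ * R⁻¹) *ᵥ y) := by
    rw [← Matrix.mulVec_mulVec, Matrix.dotProduct_mulVec β, Matrix.vecMul_transpose]
  have h2 : (F *ᵥ β) ⬝ᵥ (R⁻¹ *ᵥ (F *ᵥ β)) = β ⬝ᵥ ((Fᵀ * R⁻¹ * F) *ᵥ β) := by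
    rw [← Matrix.mulVec_mulVec, ← Matrix.mulVec_mulVec, Matrix.dotProduct_mulVec β,
      Matrix.vecMul_transpose]
  have h3 : y ⬝ᵥ ((R⁻¹ * F * (Fᵀ * R⁻¹ * F)⁻¹ * Fᵀ * R⁻¹) *ᵥ y) =
      ((Fᵀ * R⁻¹) *ᵥ y) ⬝ᵥ ((Fᵀ * R⁻¹ * F)⁻¹ *ᵥ ((Fᵀ * R⁻¹) *ᵥ y)) := by
    rw [show R⁻¹ * F * (Fᵀ * R⁻¹ * F)⁻¹ * Fᵀ * R⁻¹ =
      (Fᵀ * R⁻¹)ᵀ * ((Fᵀ * R⁻¹ * F)⁻¹ * (Fᵀ * R⁻¹)) by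
        rw [Matrix.transpose_mul, Matrix.transpose_transpose, hW.eq]
        simp only [Matrix.mul_assoc], ← Matrix.mulVec_mulVec, Matrix.dotProduct_mulVec,
      Matrix.vecMul_transpose, Matrix.mulVec_mulVec _ (Fᵀ * R⁻¹ * F)⁻¹]
  rw [hW.dotProduct_mulVec_sub, hW.dotProduct_mulVec_comm y (F *ᵥ β), h1, h2, residual, gls,
    Matrix.sub_mulVec, dotProduct_sub, h3]
  linarith

lemma residual_nonneg {F : Matrix ι κ ℝ} {R : Matrix ι ι ℝ} (hR : R.PosDef)
    (hF : LinearIndependent ℝ F.col) (y : ι → ℝ) : 0 ≤ residual F R y := by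
  have h := quadratic_eq_gls_add_residual hR hF y (gls F R y)
  rw [sub_self, zero_dotProduct, zero_add] at h
  rw [← h]
  simpa using hR.inv.posSemidef.dotProduct_mulVec_nonneg (y - F *ᵥ gls F R y)

lemma residual_pos {F : Matrix ι κ ℝ} {R : Matrix ι ι ℝ} (hR : R.PosDef)
    (hF : LinearIndependent ℝ F.col) {y : ι → ℝ} (hy : ∀ β, F *ᵥ β ≠ y) :
    0 < residual F R y := by
  have h := quadratic_eq_gls_add_residual hR hF y (gls F R y)
  rw [sub_self, zero_dotProduct, zero_add] at h
  rw [← h]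
  simpa using hR.inv.dotProduct_mulVec_pos (sub_ne_zero.2 (hy (gls F R y)).symm)

omit [DecidableEq ι] [DecidableEq κ] in
-- An injective `F` that misses `y` has a proper range. This is what makes the shape (n - p)/2 of
-- the non-informative case positive.
lemma card_lt_card_of_forall_mulVec_ne {F : Matrix ι κ ℝ}
    (hF : LinearIndependent ℝ F.col) {y : ι → ℝ} (hy : ∀ β, F *ᵥ β ≠ y) :
    Fintype.card κ < Fintype.card ι := by
  have hinj : Function.Injective F.mulVecLin := Matrix.mulVec_injective_iff.2 hF
  have h1 := LinearMap.finrank_range_of_inj hinj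
  have h2 : LinearMap.range F.mulVecLin ≠ ⊤ := fun h => by
    obtain ⟨β, hβ⟩ := LinearMap.range_eq_top.1 h y
    exact hy β hβ
  have h3 := Submodule.finrank_lt h2
  rw [h1] at h3
  simpa using h3

/-- A Woodbury identity. The right-hand side is what completing the square leaves over, the
left-hand side is the form in which `postQ` is stated. -/
lemma inv_add_inv_inv {G D : Matrix κ κ ℝ} (hG : IsUnit G.det) (hD : IsUnit D.det)
    (hGD : IsUnit (G + D).det) : (D⁻¹ + G⁻¹)⁻¹ = D - D * (G + D)⁻¹ * D := by
  apply Matrix.inv_eq_left_inv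
  have h : D * D⁻¹ + D * G⁻¹ = (G + D) * G⁻¹ := by
    rw [Matrix.add_mul, Matrix.mul_nonsing_inv _ hG, Matrix.mul_nonsing_inv _ hD]
  rw [Matrix.sub_mul, Matrix.mul_assoc _ D, Matrix.mul_add, h, Matrix.mul_assoc D, ← Matrix.mul_assoc (G + D)⁻¹, Matrix.nonsing_inv_mul _ hGD, Matrix.one_mul,
    ← h, Matrix.mul_nonsing_inv _ hD, add_sub_cancel_right]

/-- Combines data precision `G` around `g` with prior precision `D` around `b`. With the origin
moved to `g`, the linear term is `D *ᵥ (b - g)`, and completing the square leaves a form in `b - g`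
alone. -/
lemma quadratic_add_quadratic {G D : Matrix κ κ ℝ} (hG : G.PosDef) (hD : D.PosDef)
    (β g b : κ → ℝ) :
    (β - g) ⬝ᵥ (G *ᵥ (β - g)) + (β - b) ⬝ᵥ (D *ᵥ (β - b)) =
      (β - (G + D)⁻¹ *ᵥ (G *ᵥ g + D *ᵥ b)) ⬝ᵥ
          ((G + D) *ᵥ (β - (G + D)⁻¹ *ᵥ (G *ᵥ g + D *ᵥ b))) +
        (b - g) ⬝ᵥ ((D⁻¹ + G⁻¹)⁻¹ *ᵥ (b - g)) := by
  have hM := hG.add hD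
  have hMu := hM.det_pos.ne'.isUnit
  have hm : (G + D)⁻¹ *ᵥ (G *ᵥ g + D *ᵥ b) = g + (G + D)⁻¹ *ᵥ (D *ᵥ (b - g)) := by
    rw [show G *ᵥ g + D *ᵥ b = (G + D) *ᵥ g + D *ᵥ (b - g) by
      rw [Matrix.add_mulVec, Matrix.mulVec_sub]; abel, Matrix.mulVec_add,
      Matrix.mulVec_mulVec _ _ (G + D), Matrix.nonsing_inv_mul _ hMu, Matrix.one_mulVec]
  have h := hM.isSymm.complete_square hMu (β - g) (D *ᵥ (b - g))
  rw [hm, ← sub_sub, inv_add_inv_inv hG.det_pos.ne'.isUnit hD.det_pos.ne'.isUnit hMu,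
    show β - b = (β - g) - (b - g) by abel, hD.isSymm.dotProduct_mulVec_sub, Matrix.sub_mulVec,
    dotProduct_sub, ← Matrix.mulVec_mulVec, ← Matrix.mulVec_mulVec,
    hD.isSymm.dotProduct_mulVec_comm (b - g) ((G + D)⁻¹ *ᵥ (D *ᵥ (b - g))),
    dotProduct_comm ((G + D)⁻¹ *ᵥ (D *ᵥ (b - g)))]
  rw [Matrix.add_mulVec G D (β - g), dotProduct_add] at h
  linarith

end LevelPrior

end Quadratic

/-! ### The normal-inverse-gamma density -/

section NormalInvGamma

variable {ι κ : Type*} [Fintype ι] [DecidableEq ι] [Fintype κ] [DecidableEq κ]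

/-- Joint density of `(β, s)` where `s ~ IG(a, Q)` and `β | s ~ N(m, s • B)`. -/
def normalInvGammaDensity (m : κ → ℝ) (B : Matrix κ κ ℝ) (a Q : ℝ) (q : (κ → ℝ) × ℝ) : ℝ :=
  gaussianDensity m (q.2 • B) q.1 * invGammaDensity a Q q.2

lemma normalInvGammaDensity_of_nonpos {m : κ → ℝ} {B : Matrix κ κ ℝ} {a Q : ℝ} {β : κ → ℝ} {s : ℝ}
    (hs : s ≤ 0) : normalInvGammaDensity m B a Q (β, s) = 0 := by
  rw [normalInvGammaDensity, invGammaDensity_of_nonpos hs, mul_zero]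

lemma normalInvGammaDensity_nonneg (m : κ → ℝ) (B : Matrix κ κ ℝ) {a Q : ℝ} (ha : 0 < a)
    (hQ : 0 < Q) (q : (κ → ℝ) × ℝ) : 0 ≤ normalInvGammaDensity m B a Q q := by
  rcases le_or_gt q.2 0 with h | h
  · exact (normalInvGammaDensity_of_nonpos h).ge
  · exact mul_nonneg (gaussianDensity_nonneg _ _ _) (invGammaDensity_pos ha hQ h).le

/-- The explicit formula removes the inverse and determinant of `q.2 • B`. It may be used for all
`q.2`, as the inverse-gamma factor kills the nonpositive ones. -/
lemma measurable_normalInvGammaDensity (m : κ → ℝ) {B : Matrix κ κ ℝ} (hB : B.PosDef) (a Q : ℝ) :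
    Measurable (normalInvGammaDensity m B a Q) := by
  have h : normalInvGammaDensity m B a Q = fun q =>
      ((Real.sqrt ((2 * Real.pi) ^ Fintype.card κ * B.det))⁻¹ *
        (q.2 ^ ((Fintype.card κ : ℝ) / 2))⁻¹ *
        Real.exp (-((q.1 - m) ⬝ᵥ (B⁻¹ *ᵥ (q.1 - m)) / 2 / q.2))) * invGammaDensity a Q q.2 := by
    ext ⟨β, s⟩
    rcases le_or_gt s 0 with hs | hs
    · rw [normalInvGammaDensity_of_nonpos hs, invGammaDensity_of_nonpos hs, mul_zero]
    · rw [normalInvGammaDensity, gaussianDensity_smul hs hB.det_pos]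
  have hquad : Measurable fun q : (κ → ℝ) × ℝ => (q.1 - m) ⬝ᵥ (B⁻¹ *ᵥ (q.1 - m)) :=
    Continuous.measurable (by fun_prop)
  have := measurable_invGammaDensity a Q
  rw [h]
  fun_prop

lemma integral_normalInvGammaDensity_left (m : κ → ℝ) {B : Matrix κ κ ℝ} (hB : B.PosDef)
    (a Q s : ℝ) : ∫ β, normalInvGammaDensity m B a Q (β, s) = invGammaDensity a Q s := by
  rcases le_or_gt s 0 with hs | hs
  · simp_rw [normalInvGammaDensity_of_nonpos hs, invGammaDensity_of_nonpos hs, integral_zero]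
  · simp_rw [normalInvGammaDensity]
    rw [integral_mul_const, integral_gaussianDensity m (hB.smul hs), one_mul]

lemma integrable_normalInvGammaDensity (m : κ → ℝ) {B : Matrix κ κ ℝ} (hB : B.PosDef) {a Q : ℝ}
    (ha : 0 < a) (hQ : 0 < Q) : Integrable (normalInvGammaDensity m B a Q) := by
  refine (integrable_prod_iff'
    (measurable_normalInvGammaDensity m hB a Q).aestronglyMeasurable).2
    ⟨Filter.Eventually.of_forall fun s => ?_, ?_⟩
  · rcases le_or_gt s 0 with hs | hs
    · simp_rw [normalInvGammaDensity_of_nonpos hs]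
      exact integrable_zero _ _ _
    · exact (integrable_gaussianDensity m (hB.smul hs)).mul_const (invGammaDensity a Q s)
  · simp_rw [Real.norm_of_nonneg (normalInvGammaDensity_nonneg m B ha hQ _),
      integral_normalInvGammaDensity_left m hB]
    exact integrable_invGammaDensity ha hQ

lemma integral_normalInvGammaDensity (m : κ → ℝ) {B : Matrix κ κ ℝ} (hB : B.PosDef) {a Q : ℝ}
    (ha : 0 < a) (hQ : 0 < Q) : ∫ q, normalInvGammaDensity m B a Q q = 1 := by
  rw [Measure.volume_eq_prod,
    integral_prod_symm _ (integrable_normalInvGammaDensity m hB ha hQ)]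
  simp_rw [integral_normalInvGammaDensity_left m hB]
  exact integral_invGammaDensity ha hQ

namespace LevelPrior

omit [Fintype κ] [DecidableEq κ] in
lemma varDensity_of_nonpos (π : LevelPrior κ) {s : ℝ} (hs : s ≤ 0) : π.varDensity s = 0 := by
  cases π with
  | informative α γ b v => exact invGammaDensity_of_nonpos hs
  | jeffreys c c' => exact if_neg hs.not_gt

omit [DecidableEq ι] [DecidableEq κ] in
lemma postShape_pos {π : LevelPrior κ} (hπ : π.Valid) {F : Matrix ι κ ℝ}
    (hF : LinearIndependent ℝ F.col) {y : ι → ℝ} (hy : π.IsJeffreys → ∀ β, F *ᵥ β ≠ y) :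
    0 < π.postShape ι := by
  cases π with
  | informative α γ b v =>
    have : 0 < α := hπ.1
    simp only [postShape]
    positivity
  | jeffreys c c' =>
    have : (Fintype.card κ : ℝ) < Fintype.card ι :=
      Nat.cast_lt.2 (card_lt_card_of_forall_mulVec_ne hF (hy trivial))
    simp only [postShape]
    linarith

lemma postQ_pos {π : LevelPrior κ} (hπ : π.Valid) {F : Matrix ι κ ℝ} {R : Matrix ι ι ℝ}
    (hR : R.PosDef) (hF : LinearIndependent ℝ F.col) {y : ι → ℝ}
    (hy : π.IsJeffreys → ∀ β, F *ᵥ β ≠ y) : 0 < π.postQ F R y := by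
  cases π with
  | informative α γ b v =>
    have h1 : 0 < γ := hπ.2.1
    have h2 := residual_nonneg hR hF y
    have h3 := ((Matrix.PosDef.diagonal hπ.2.2).add
      (posDef_transpose_mul_inv_mul hR hF).inv).inv.posSemidef.dotProduct_mulVec_nonneg
        (b - gls F R y)
    rw [star_trivial] at h3
    simp only [postQ]
    linarith
  | jeffreys c c' => exact residual_pos hR hF (hy trivial)

omit [DecidableEq κ] in
lemma smul_mulVec_inv_smul {s : ℝ} (hs : 0 < s) (B : Matrix κ κ ℝ) (x : κ → ℝ) :
    (s • B) *ᵥ (s⁻¹ • x) = B *ᵥ x := by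
  rw [Matrix.smul_mulVec, Matrix.mulVec_smul, smul_smul, mul_inv_cancel₀ hs.ne', one_smul]

/-- Likelihood times prior of one level is proportional to a normal-inverse-gamma density. -/
lemma exists_likelihood_mul_prior_eq {π : LevelPrior κ} (hπ : π.Valid) {F : Matrix ι κ ℝ}
    {R : Matrix ι ι ℝ} (hR : R.PosDef) (hF : LinearIndependent ℝ F.col) {y : ι → ℝ}
    (hy : π.IsJeffreys → ∀ β, F *ᵥ β ≠ y) :
    ∃ (C : ℝ) (m : κ → ℝ) (B : Matrix κ κ ℝ), 0 < C ∧ B.PosDef ∧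
      (∀ s, 0 < s → π.postCov F R s = s • B) ∧
      (∀ s, 0 < s → π.postCov F R s *ᵥ π.postVec F R y s = m) ∧
      ∀ β s, gaussianDensity (F *ᵥ β) (s • R) y * (π.coefDensity s β * π.varDensity s) =
        C * normalInvGammaDensity m B (π.postShape ι) (π.postQ F R y / 2) (β, s) := by
  have hG := posDef_transpose_mul_inv_mul hR hF
  have ha := postShape_pos hπ hF hy
  have hQ := half_pos (postQ_pos hπ hR hF hy)
  -- Normalising constants are made opaque so that the final identity is algebraic in a few atoms.
  obtain ⟨g, hg⟩ : ∃ g, g = (π.postQ F R y / 2) ^ π.postShape ι /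
    Real.Gamma (π.postShape ι) := ⟨_, rfl⟩
  have hg0 : 0 < g := hg ▸ div_pos (Real.rpow_pos_of_pos hQ _) (Real.Gamma_pos_of_pos ha)
  obtain ⟨k, hk⟩ : ∃ k, k = (Real.sqrt ((2 * Real.pi) ^ Fintype.card ι * R.det))⁻¹ := ⟨_, rfl⟩
  have hRdet := hR.det_pos
  have hk0 : 0 < k := by rw [hk]; positivity
  have hgls : (Fᵀ * R⁻¹) *ᵥ y = (Fᵀ * R⁻¹ * F) *ᵥ gls F R y := by
    rw [gls, Matrix.mulVec_mulVec, Matrix.mul_nonsing_inv _ hG.det_pos.ne'.isUnit,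
      Matrix.one_mulVec]
  cases π with
  | informative α γ b v =>
    obtain ⟨hα, hγ, hv⟩ := hπ
    have hV := Matrix.PosDef.diagonal hv
    have hVdet := hV.det_pos
    obtain ⟨M, hM⟩ : ∃ M, M = Fᵀ * R⁻¹ * F + (Matrix.diagonal v)⁻¹ := ⟨_, rfl⟩
    have hMpos : M.PosDef := hM ▸ hG.add hV.inv
    have hMu := hMpos.det_pos.ne'.isUnit
    have hBdet := hMpos.inv.det_pos
    obtain ⟨m, hm⟩ : ∃ m, m = M⁻¹ *ᵥ ((Fᵀ * R⁻¹) *ᵥ y + (Matrix.diagonal v)⁻¹ *ᵥ b) :=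
      ⟨_, rfl⟩
    obtain ⟨k₂, hk₂⟩ : ∃ k₂, k₂ =
      (Real.sqrt ((2 * Real.pi) ^ Fintype.card κ * (Matrix.diagonal v).det))⁻¹ := ⟨_, rfl⟩
    have hk₂0 : 0 < k₂ := by rw [hk₂]; positivity
    obtain ⟨k₃, hk₃⟩ : ∃ k₃, k₃ = γ ^ α / Real.Gamma α := ⟨_, rfl⟩
    have hk₃0 : 0 < k₃ :=
      hk₃ ▸ div_pos (Real.rpow_pos_of_pos hγ _) (Real.Gamma_pos_of_pos hα)
    obtain ⟨k₄, hk₄⟩ : ∃ k₄, k₄ =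
      (Real.sqrt ((2 * Real.pi) ^ Fintype.card κ * M⁻¹.det))⁻¹ := ⟨_, rfl⟩
    have hk₄0 : 0 < k₄ := by rw [hk₄]; positivity
    have hcov : ∀ s, 0 < s → (informative α γ b v).postCov F R s = s • M⁻¹ := by
      intro s hs
      rw [postCov, Matrix.mul_smul, Matrix.smul_mul, ← smul_add, ← hM,
        Matrix.inv_smul_of_ne_zero (inv_ne_zero hs.ne') hMu, inv_inv]
    -- Constants of the likelihood and the two priors, divided by those of the posterior normal
    -- (`k₄`) and inverse-gamma (`g`) densities.
    refine ⟨k * k₂ * k₃ / (k₄ * g), m, M⁻¹, by positivity, hMpos.inv, hcov, fun s hs => ?_,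
      fun β s => ?_⟩
    · rw [hcov s hs, postVec, Matrix.mul_smul, Matrix.smul_mulVec s⁻¹ (Fᵀ * R⁻¹),
        Matrix.smul_mulVec s⁻¹ (Matrix.diagonal v)⁻¹, ← smul_add, smul_mulVec_inv_smul hs, hm]
    · rcases le_or_gt s 0 with hs | hs
      · rw [varDensity_of_nonpos _ hs, normalInvGammaDensity_of_nonpos hs]
        simp
      have hq := quadratic_add_quadratic hG hV.inv β (gls F R y) b
      rw [← hgls, Matrix.nonsing_inv_nonsing_inv _ hVdet.ne'.isUnit, ← hM, ← hm,
        ← sub_eq_iff_eq_add] at hq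
      have hexp : Real.exp (-((y - F *ᵥ β) ⬝ᵥ (R⁻¹ *ᵥ (y - F *ᵥ β)) / 2 / s)) *
          Real.exp (-((β - b) ⬝ᵥ ((Matrix.diagonal v)⁻¹ *ᵥ (β - b)) / 2 / s)) *
          Real.exp (-(γ / s)) =
          Real.exp (-((β - m) ⬝ᵥ (M⁻¹⁻¹ *ᵥ (β - m)) / 2 / s)) *
          Real.exp (-((informative α γ b v).postQ F R y / 2 / s)) := by
        rw [← Real.exp_add, ← Real.exp_add, ← Real.exp_add, Matrix.nonsing_inv_nonsing_inv _ hMu,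
          quadratic_eq_gls_add_residual hR hF, postQ, ← hq]
        congr 1
        ring
      -- Only the likelihood's power s^(n/2) shifts the shape: the powers s^(p/2) of the prior and
      -- posterior normal densities cancel.
      have hpow : s ^ ((informative α γ b v).postShape ι + 1) =
          s ^ ((Fintype.card ι : ℝ) / 2) * s ^ (α + 1) := by
        rw [← Real.rpow_add hs, postShape, add_assoc]
      have h1 := Real.rpow_pos_of_pos hs ((Fintype.card ι : ℝ) / 2)
      have h2 := Real.rpow_pos_of_pos hs ((Fintype.card κ : ℝ) / 2)
      have h3 := Real.rpow_pos_of_pos hs (α + 1)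
      rw [normalInvGammaDensity, gaussianDensity_smul hs hRdet, coefDensity, varDensity,
        gaussianDensity_smul hs hVdet, gaussianDensity_smul hs hBdet, invGammaDensity_of_pos hs,
        invGammaDensity_of_pos hs, ← hk, ← hk₂, ← hk₃, ← hk₄, ← hg, hpow]
      generalize Real.exp (-(γ / s)) = e₁ at *
      generalize Real.exp (-((y - F *ᵥ β) ⬝ᵥ (R⁻¹ *ᵥ (y - F *ᵥ β)) / 2 / s)) = e₂ at *
      generalize
        Real.exp (-((β - b) ⬝ᵥ ((Matrix.diagonal v)⁻¹ *ᵥ (β - b)) / 2 / s)) = e₃ at *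
      generalize Real.exp (-((β - m) ⬝ᵥ (M⁻¹⁻¹ *ᵥ (β - m)) / 2 / s)) = e₄ at *
      generalize Real.exp (-((informative α γ b v).postQ F R y / 2 / s)) = e₅ at *
      field_simp
      linear_combination hexp
  | jeffreys c c' =>
    obtain ⟨hc, hc'⟩ := hπ
    obtain ⟨G, hGdef⟩ : ∃ G, G = Fᵀ * R⁻¹ * F := ⟨_, rfl⟩
    rw [← hGdef] at hG
    have hGu := hG.det_pos.ne'.isUnit
    have hBdet := hG.inv.det_pos
    obtain ⟨k₄, hk₄⟩ : ∃ k₄, k₄ =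
      (Real.sqrt ((2 * Real.pi) ^ Fintype.card κ * G⁻¹.det))⁻¹ := ⟨_, rfl⟩
    have hk₄0 : 0 < k₄ := by rw [hk₄]; positivity
    have hcov : ∀ s, 0 < s → (jeffreys c c').postCov F R s = s • G⁻¹ := by
      intro s hs
      rw [postCov, Matrix.mul_smul, Matrix.smul_mul, ← hGdef,
        Matrix.inv_smul_of_ne_zero (inv_ne_zero hs.ne') hGu, inv_inv]
    refine ⟨k * c * c' / (k₄ * g), gls F R y, G⁻¹, by positivity, hG.inv, hcov, fun s hs => ?_,
      fun β s => ?_⟩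
    · rw [hcov s hs, postVec, Matrix.mul_smul, Matrix.smul_mulVec s⁻¹,
        smul_mulVec_inv_smul hs, gls, hGdef]
    · rcases le_or_gt s 0 with hs | hs
      · rw [varDensity_of_nonpos _ hs, normalInvGammaDensity_of_nonpos hs]
        simp
      have hexp : Real.exp (-((y - F *ᵥ β) ⬝ᵥ (R⁻¹ *ᵥ (y - F *ᵥ β)) / 2 / s)) =
          Real.exp (-((β - gls F R y) ⬝ᵥ (G⁻¹⁻¹ *ᵥ (β - gls F R y)) / 2 / s)) *
          Real.exp (-((jeffreys c c' : LevelPrior κ).postQ F R y / 2 / s)) := by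
        rw [← Real.exp_add, Matrix.nonsing_inv_nonsing_inv _ hGu,
          quadratic_eq_gls_add_residual hR hF, postQ, ← hGdef]
        congr 1
        ring
      -- With a flat prior nothing cancels the s^(p/2) of the posterior normal density, whence the
      -- shape (n - p)/2; the prior 1/s supplies the +1 in the inverse-gamma exponent.
      have hpow : s ^ ((Fintype.card ι : ℝ) / 2) * s =
          s ^ ((Fintype.card κ : ℝ) / 2) *
            s ^ ((jeffreys c c' : LevelPrior κ).postShape ι + 1) := by
        rw [← Real.rpow_add_one hs.ne', ← Real.rpow_add hs, postShape]
        congr 1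
        ring
      have h1 := Real.rpow_pos_of_pos hs ((Fintype.card ι : ℝ) / 2)
      have h2 := Real.rpow_pos_of_pos hs ((Fintype.card κ : ℝ) / 2)
      have h3 := Real.rpow_pos_of_pos hs ((jeffreys c c' : LevelPrior κ).postShape ι + 1)
      rw [normalInvGammaDensity, gaussianDensity_smul hs hRdet, coefDensity, varDensity,
        if_pos hs, gaussianDensity_smul hs hBdet, invGammaDensity_of_pos hs, ← hk, ← hk₄, ← hg,
        hexp]
      generalize s ^ ((jeffreys c c' : LevelPrior κ).postShape ι + 1) = w at *
      generalize s ^ ((Fintype.card κ : ℝ) / 2) = t at *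
      generalize s ^ ((Fintype.card ι : ℝ) / 2) = p at *
      field_simp
      linear_combination -hpow

end LevelPrior

end NormalInvGamma

/-! ### Gaussian marginals, block matrices and regrouping of product measures. -/

lemma ProbabilityTheory.IsGaussianProcess.hasGaussianLaw_fintype {T Ω ι : Type*} [Fintype ι]
    [MeasurableSpace Ω] {P : Measure Ω} {X : T → Ω → ℝ} (hX : IsGaussianProcess X P) (D : ι → T) :
    HasGaussianLaw (fun ω i => X (D i) ω) P := by
  let L : (↥(Finset.univ : Finset ι) → ℝ) →L[ℝ] (ι → ℝ) := LinearMap.toContinuousLinearMap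
    { toFun := fun x i => x ⟨i, Finset.mem_univ i⟩
      map_add' := fun _ _ => rfl
      map_smul' := fun _ _ => rfl }
  exact ((hX.comp_right D).hasGaussianLaw Finset.univ).map_fun L

lemma Matrix.PosDef.fromBlocks_diagonal {m n : Type*} [Fintype m] [Fintype n]
    {A : Matrix m m ℝ} {D : Matrix n n ℝ} (hA : A.PosDef) (hD : D.PosDef) :
    (Matrix.fromBlocks A 0 0 D).PosDef := by
  refine .of_dotProduct_mulVec_pos ?_ fun x hx => ?_
  · rw [Matrix.isHermitian_fromBlocks_iff]
    exact ⟨hA.isHermitian, by simp, by simp, hD.isHermitian⟩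
  · rw [star_trivial, Matrix.fromBlocks_mulVec, ← Sum.elim_comp_inl_inr x]
    simp only [Sum.elim_comp_inl, Sum.elim_comp_inr, Matrix.zero_mulVec, add_zero, zero_add,
      sumElim_dotProduct_sumElim]
    have h1 := hA.posSemidef.dotProduct_mulVec_nonneg (x ∘ Sum.inl)
    have h2 := hD.posSemidef.dotProduct_mulVec_nonneg (x ∘ Sum.inr)
    rw [star_trivial] at h1 h2
    by_cases hl : x ∘ Sum.inl = 0
    · have hr : x ∘ Sum.inr ≠ 0 := fun hr => hx (by
        rw [← Sum.elim_comp_inl_inr x, hl, hr]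
        ext (i | i) <;> rfl)
      have h3 := hD.dotProduct_mulVec_pos hr
      rw [star_trivial] at h3
      linarith
    · have h3 := hA.dotProduct_mulVec_pos hl
      rw [star_trivial] at h3
      linarith

/-- Regroups the parameters by level, so that the full normalising integral splits into a product.
-/
lemma MeasureTheory.measurePreserving_prod_shuffle {α β γ δ : Type*} [MeasureSpace α]
    [MeasureSpace β] [MeasureSpace γ] [MeasureSpace δ] [SigmaFinite (volume : Measure α)]
    [SigmaFinite (volume : Measure β)] [SigmaFinite (volume : Measure γ)]
    [SigmaFinite (volume : Measure δ)] :
    MeasurePreserving (fun q : α × β × γ × δ => ((q.1, q.2.2.1), (q.2.1, q.2.2.2))) := by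
  have h1 : MeasurePreserving (fun q : β × γ × δ => (q.2.1, (q.1, q.2.2))) :=
    (measurePreserving_prodAssoc (volume : Measure γ) (volume : Measure β)
      (volume : Measure δ)).comp ((Measure.measurePreserving_swap.prod (.id volume)).comp
        ((measurePreserving_prodAssoc (volume : Measure β) (volume : Measure γ)
          (volume : Measure δ)).symm _))
  exact ((measurePreserving_prodAssoc (volume : Measure α) (volume : Measure γ)
    (volume : Measure (β × δ))).symm _).comp ((MeasurePreserving.id volume).prod h1)

namespace TwoLevelModel

variable {d n₁ n₂ p₁ p₂ : ℕ} {Θ₁ Θ₂ : Type*} (M : TwoLevelModel d n₁ n₂ p₁ p₂ Θ₁ Θ₂)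

/-! ### The covariance matrix of the observations and the likelihood -/

/-- The position in the first design of each point of the second one. -/
def nestedIndex (j : Fin n₂) : Fin n₁ := (M.nested (Set.mem_range_self j)).choose

lemma D₁_nestedIndex (j : Fin n₂) : M.D₁ (M.nestedIndex j) = M.D₂ j :=
  (M.nested (Set.mem_range_self j)).choose_spec

/-- The matrix sending a vector of values on the first design to its restriction to the second. -/
def selection : Matrix (Fin n₂) (Fin n₁) ℝ := (1 : Matrix (Fin n₁) (Fin n₁) ℝ).submatrix
  M.nestedIndex id

lemma selection_mulVec (x : Fin n₁ → ℝ) : M.selection *ᵥ x = x ∘ M.nestedIndex := by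
  ext j
  simp [selection, Matrix.mulVec, dotProduct, Matrix.one_apply]

lemma selection_mul {k : ℕ} (A : Matrix (Fin n₁) (Fin k) ℝ) :
    M.selection * A = A.submatrix M.nestedIndex id := by
  ext j i
  simp [selection, Matrix.mul_apply, Matrix.one_apply]

lemma mul_selection_transpose {k : ℕ} (A : Matrix (Fin k) (Fin n₁) ℝ) :
    A * M.selectionᵀ = A.submatrix id M.nestedIndex := by
  ext j i
  simp [selection, Matrix.mul_apply, Matrix.one_apply]

/-- The unipotent matrix expressing the observations through the first level and the discrepancy. -/
def mixing (ρ : ℝ) : Matrix (Fin n₁ ⊕ Fin n₂) (Fin n₁ ⊕ Fin n₂) ℝ :=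
  Matrix.fromBlocks 1 0 (ρ • M.selection) 1

lemma det_mixing (ρ : ℝ) : (M.mixing ρ).det = 1 := by
  simp [mixing]

/-- The block diagonal factor is the covariance of the independent pair (`Z₁(D₁)`, `δ(D₂)`).
Nestedness enters here: every block of `R₁` involving `D₂` is obtained from `R₁(D₁)` by selecting
rows or columns. -/
lemma V_eq_mixing_mul (θ₁ : Θ₁) (θ₂ : Θ₂) (ρ s₁ s₂ : ℝ) :
    M.V θ₁ θ₂ ρ s₁ s₂ = M.mixing ρ *
      Matrix.fromBlocks (s₁ • M.R₁ θ₁ M.D₁ M.D₁) 0 0 (s₂ • M.R₂ θ₂ M.D₂ M.D₂) *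
        (M.mixing ρ)ᵀ := by
  have h12 : M.R₁ θ₁ M.D₁ M.D₂ = M.R₁ θ₁ M.D₁ M.D₁ * M.selectionᵀ := by
    rw [mul_selection_transpose]
    ext i j
    simp [R₁, D₁_nestedIndex]
  have h21 : M.R₁ θ₁ M.D₂ M.D₁ = M.selection * M.R₁ θ₁ M.D₁ M.D₁ := by
    rw [selection_mul]
    ext i j
    simp [R₁, D₁_nestedIndex]
  have h22 : M.R₁ θ₁ M.D₂ M.D₂ = M.selection * M.R₁ θ₁ M.D₁ M.D₁ * M.selectionᵀ := by
    rw [mul_selection_transpose, selection_mul]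
    ext i j
    simp [R₁, D₁_nestedIndex]
  rw [V, h12, h21, h22, mixing, Matrix.fromBlocks_transpose, Matrix.fromBlocks_multiply,
    Matrix.fromBlocks_multiply]
  simp [smul_smul, mul_comm, sq, mul_left_comm]

lemma posDef_V {θ₁ : Θ₁} {θ₂ : Θ₂} (hR₁ : (M.R₁ θ₁ M.D₁ M.D₁).PosDef)
    (hR₂ : (M.R₂ θ₂ M.D₂ M.D₂).PosDef) (ρ : ℝ) {s₁ s₂ : ℝ} (hs₁ : 0 < s₁) (hs₂ : 0 < s₂) :
    (M.V θ₁ θ₂ ρ s₁ s₂).PosDef := by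
  rw [V_eq_mixing_mul, ← Matrix.conjTranspose_eq_transpose_of_trivial]
  refine ((hR₁.smul hs₁).fromBlocks_diagonal (hR₂.smul hs₂)).mul_mul_conjTranspose_same ?_
  rw [Matrix.vecMul_injective_iff_isUnit, Matrix.isUnit_iff_isUnit_det, det_mixing]
  exact isUnit_one

/-- The chain rule p(z₁, z₂) = p(z₁) p(z₂ | z₁): mean, data and covariance are all images under
`mixing ρ`, and removing it makes the covariance block diagonal. -/
lemma likelihood_eq_mul {θ₁ : Θ₁} {θ₂ : Θ₂} (hR₁ : (M.R₁ θ₁ M.D₁ M.D₁).PosDef)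
    (hR₂ : (M.R₂ θ₂ M.D₂ M.D₂).PosDef) {s₁ s₂ : ℝ} (hs₁ : 0 < s₁) (hs₂ : 0 < s₂)
    (β₁ : Fin p₁ → ℝ) (lam : Unit ⊕ Fin p₂ → ℝ) (z₁ z₂ : M.Q → ℝ) :
    M.likelihood θ₁ θ₂ β₁ (lam ∘ Sum.inr) (lam (Sum.inl ())) s₁ s₂ (M.obs z₁ z₂) =
      M.likelihood₁ θ₁ β₁ s₁ (z₁ ∘ M.D₁) *
        gaussianDensity (M.F z₁ *ᵥ lam) (s₂ • M.R₂ θ₂ M.D₂ M.D₂) (z₂ ∘ M.D₂) := by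
  obtain ⟨ρ, hρ⟩ : ∃ ρ, ρ = lam (Sum.inl ()) := ⟨_, rfl⟩
  have hmean : M.H ρ *ᵥ Sum.elim β₁ (lam ∘ Sum.inr) =
      0 + M.mixing ρ *ᵥ Sum.elim (M.F₁ M.D₁ *ᵥ β₁) (M.F₂ M.D₂ *ᵥ (lam ∘ Sum.inr)) := by
    have : M.F₁ M.D₂ = M.selection * M.F₁ M.D₁ := by
      rw [selection_mul]
      ext i j
      simp [F₁, D₁_nestedIndex]
    rw [zero_add, H, mixing, this, Matrix.fromBlocks_mulVec, Matrix.fromBlocks_mulVec]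
    simp [Matrix.smul_mulVec]
  have hobs : M.obs z₁ z₂ = 0 + M.mixing ρ *ᵥ
      Sum.elim (z₁ ∘ M.D₁) (z₂ ∘ M.D₂ - ρ • (z₁ ∘ M.D₂)) := by
    rw [zero_add, obs, mixing, Matrix.fromBlocks_mulVec]
    simp only [Sum.elim_comp_inl, Sum.elim_comp_inr, Matrix.one_mulVec, Matrix.zero_mulVec,
      add_zero, Matrix.smul_mulVec, selection_mulVec]
    congr 1
    ext j
    simp [D₁_nestedIndex]
  -- The term `ρ • z₁(D₂)` passes from the data to the mean, where `ρ` is the coefficient of the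
  -- first column of `F`.
  have hdiff : z₂ ∘ M.D₂ - ρ • (z₁ ∘ M.D₂) - M.F₂ M.D₂ *ᵥ (lam ∘ Sum.inr) =
      z₂ ∘ M.D₂ - M.F z₁ *ᵥ lam := by
    ext j
    simp [F, F₂, lamVec, Matrix.mulVec, dotProduct, hρ]
    ring
  rw [← hρ, likelihood, hmean, hobs, V_eq_mixing_mul,
    gaussianDensity_conj (by rw [det_mixing]; exact one_ne_zero), det_mixing,
    gaussianDensity_fromBlocks (hR₁.smul hs₁).det_pos (hR₂.smul hs₂).det_pos, abs_one, inv_one,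
    one_mul, likelihood₁]
  congr 1
  rw [gaussianDensity, hdiff, gaussianDensity]

/-! ### The law of the observations -/

section Law

variable {M} {θ₁ : Θ₁} {θ₂ : Θ₂} {β₁ : Fin p₁ → ℝ} {β₂ : Fin p₂ → ℝ} {ρ s₁ s₂ : ℝ}
  {Ω : Type*} [MeasurableSpace Ω] {P : Measure Ω} {Z₁ Z₂ δ : M.Q → Ω → ℝ}

namespace IsAutoregressive

lemma map_level₁_eq_withDensity (h : M.IsAutoregressive θ₁ θ₂ β₁ β₂ ρ s₁ s₂ P Z₁ Z₂ δ)
    (hR₁ : (M.R₁ θ₁ M.D₁ M.D₁).PosDef) (hs₁ : 0 < s₁) :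
    P.map (fun ω i => Z₁ (M.D₁ i) ω) =
      volume.withDensity (fun y => ENNReal.ofReal (M.likelihood₁ θ₁ β₁ s₁ y)) :=
  (h.level₁.gaussian.hasGaussianLaw_fintype M.D₁).map_eq_withDensity
    (X := fun i => Z₁ (M.D₁ i)) (hR₁.smul hs₁) (fun i => h.level₁.mean (M.D₁ i))
    (fun i j => h.level₁.covariance (M.D₁ i) (M.D₁ j))

lemma eq_autoregression (h : M.IsAutoregressive θ₁ θ₂ β₁ β₂ ρ s₁ s₂ P Z₁ Z₂ δ) (x : M.Q) :
    Z₂ x = (fun ω => ρ * Z₁ x ω) + δ x :=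
  funext fun ω => h.autoregression x ω

/-- Independence makes the pair (`Z₁(D₁)`, `δ(D₂)`) jointly Gaussian, and by nestedness the
observations are a linear image of it. -/
lemma hasGaussianLaw_obs (h : M.IsAutoregressive θ₁ θ₂ β₁ β₂ ρ s₁ s₂ P Z₁ Z₂ δ) :
    HasGaussianLaw (fun ω k => Sum.elim (fun i => Z₁ (M.D₁ i)) (fun j => Z₂ (M.D₂ j)) k ω) P := by
  have hφ : Measurable fun (f : M.Q → ℝ) (i : Fin n₁) => f (M.D₁ i) := by fun_prop
  have hψ : Measurable fun (f : M.Q → ℝ) (j : Fin n₂) => f (M.D₂ j) := by fun_prop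
  have hpair := IndepFun.hasGaussianLaw (h.level₁.gaussian.hasGaussianLaw_fintype M.D₁)
    (h.discrepancy.gaussian.hasGaussianLaw_fintype M.D₂) (h.indep.comp hφ hψ)
  let L : (Fin n₁ → ℝ) × (Fin n₂ → ℝ) →L[ℝ] (Fin n₁ ⊕ Fin n₂ → ℝ) :=
    LinearMap.toContinuousLinearMap
      { toFun := fun x => Sum.elim x.1 (fun j => ρ * x.1 (M.nestedIndex j) + x.2 j)
        map_add' := fun x y => by
          ext (i | j)
          · rfl
          · simp
            ring
        map_smul' := fun c x => by
          ext (i | j)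
          · rfl
          · simp
            ring }
  convert! hpair.map_fun L using 2 with ω
  ext (i | j)
  · rfl
  · simp [L, h.autoregression, D₁_nestedIndex]

lemma integral_obs (h : M.IsAutoregressive θ₁ θ₂ β₁ β₂ ρ s₁ s₂ P Z₁ Z₂ δ) (k : Fin n₁ ⊕ Fin n₂) :
    ∫ ω, Sum.elim (fun i => Z₁ (M.D₁ i)) (fun j => Z₂ (M.D₂ j)) k ω ∂P =
      (M.H ρ *ᵥ Sum.elim β₁ β₂) k := by
  have hZ : ∀ x, Integrable (Z₁ x) P := fun x =>
    (h.level₁.gaussian.hasGaussianLaw_eval x).integrable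
  have hδ : ∀ x, Integrable (δ x) P := fun x =>
    (h.discrepancy.gaussian.hasGaussianLaw_eval x).integrable
  rw [H, Matrix.fromBlocks_mulVec]
  rcases k with i | j
  · simp only [Sum.elim_inl, h.level₁.mean, Sum.elim_comp_inl, Matrix.zero_mulVec, add_zero]
    rfl
  · simp only [Sum.elim_inr, h.autoregression, Sum.elim_comp_inl, Sum.elim_comp_inr]
    rw [integral_add ((hZ _).const_mul ρ) (hδ _), integral_const_mul, h.level₁.mean,
      h.discrepancy.mean, Matrix.smul_mulVec]
    rfl

lemma covariance_obs (h : M.IsAutoregressive θ₁ θ₂ β₁ β₂ ρ s₁ s₂ P Z₁ Z₂ δ)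
    (k l : Fin n₁ ⊕ Fin n₂) :
    cov[Sum.elim (fun i => Z₁ (M.D₁ i)) (fun j => Z₂ (M.D₂ j)) k,
      Sum.elim (fun i => Z₁ (M.D₁ i)) (fun j => Z₂ (M.D₂ j)) l; P] =
      M.V θ₁ θ₂ ρ s₁ s₂ k l := by
  have := h.level₁.gaussian.isProbabilityMeasure
  have hZ : ∀ x, MemLp (Z₁ x) 2 P := fun x =>
    (h.level₁.gaussian.hasGaussianLaw_eval x).memLp_two
  have hδ : ∀ x, MemLp (δ x) 2 P := fun x =>
    (h.discrepancy.gaussian.hasGaussianLaw_eval x).memLp_two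
  have h0 : ∀ x y, cov[Z₁ x, δ y; P] = 0 := fun x y =>
    IndepFun.covariance_eq_zero (X := Z₁ x) (Y := δ y)
      (h.indep.comp (measurable_pi_apply x) (measurable_pi_apply y)) (hZ x) (hδ y)
  have h0' : ∀ x y, cov[δ x, Z₁ y; P] = 0 := fun x y => by rw [covariance_comm, h0]
  have hmul : ∀ x, MemLp (fun ω => ρ * Z₁ x ω) 2 P := fun x => (hZ x).const_mul ρ
  rcases k with i | i <;> rcases l with j | j <;>
    simp only [Sum.elim_inl, Sum.elim_inr, h.eq_autoregression, V, Matrix.fromBlocks_apply₁₁,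
      Matrix.fromBlocks_apply₁₂, Matrix.fromBlocks_apply₂₁, Matrix.fromBlocks_apply₂₂,
      Matrix.smul_apply, Matrix.add_apply, R₁, R₂, Matrix.of_apply, smul_eq_mul]
  · exact h.level₁.covariance _ _
  · rw [covariance_add_right (hZ _) (hmul _) (hδ _), covariance_const_mul_right, h0,
      h.level₁.covariance]
    ring
  · rw [covariance_add_left (hmul _) (hδ _) (hZ _), covariance_const_mul_left, h0',
      h.level₁.covariance]
    ring
  · rw [covariance_add_left (hmul _) (hδ _) ((hmul _).add (hδ _)),
      covariance_add_right (hmul _) (hmul _) (hδ _), covariance_add_right (hδ _) (hmul _) (hδ _),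
      covariance_const_mul_left, covariance_const_mul_left, covariance_const_mul_right,
      covariance_const_mul_right, h0, h0', h.level₁.covariance, h.discrepancy.covariance]
    ring

lemma map_obs_eq_withDensity (h : M.IsAutoregressive θ₁ θ₂ β₁ β₂ ρ s₁ s₂ P Z₁ Z₂ δ)
    (hR₁ : (M.R₁ θ₁ M.D₁ M.D₁).PosDef) (hR₂ : (M.R₂ θ₂ M.D₂ M.D₂).PosDef) (hs₁ : 0 < s₁)
    (hs₂ : 0 < s₂) :
    P.map (fun ω => Sum.elim (fun i => Z₁ (M.D₁ i) ω) (fun j => Z₂ (M.D₂ j) ω)) =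
      volume.withDensity (fun y => ENNReal.ofReal (M.likelihood θ₁ θ₂ β₁ β₂ ρ s₁ s₂ y)) := by
  rw [show (fun ω => Sum.elim (fun i => Z₁ (M.D₁ i) ω) (fun j => Z₂ (M.D₂ j) ω)) =
      fun ω k => Sum.elim (fun i => Z₁ (M.D₁ i)) (fun j => Z₂ (M.D₂ j)) k ω by
    ext ω (i | j) <;> rfl]
  exact h.hasGaussianLaw_obs.map_eq_withDensity (M.posDef_V hR₁ hR₂ ρ hs₁ hs₂) h.integral_obs
    h.covariance_obs

end IsAutoregressive

end Law

end TwoLevelModel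

end

/-! ### Assembly of the two levels. -/

theorem mainTheorem7 {d n₁ n₂ p₁ p₂ : ℕ} {Θ₁ Θ₂ : Type*}
    (M : TwoLevelModel d n₁ n₂ p₁ p₂ Θ₁ Θ₂) (θ₁ : Θ₁) (θ₂ : Θ₂)
    (π₁ : LevelPrior (Fin p₁)) (π₂ : LevelPrior (Unit ⊕ Fin p₂))
    (z₁ z₂ : M.Q → ℝ)
    (hR₁ : (M.R₁ θ₁ M.D₁ M.D₁).PosDef) (hR₂ : (M.R₂ θ₂ M.D₂ M.D₂).PosDef)
    (hπ₁ : π₁.Valid) (hπ₂ : π₂.Valid)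
    -- the design matrices have full column rank
    (hF₁ : LinearIndependent ℝ (M.F₁ M.D₁).col) (hF : LinearIndependent ℝ (M.F z₁).col)
    -- with a non-informative prior, the data are not fitted exactly by the regression
    (hz₁ : π₁.IsJeffreys → ∀ β, M.F₁ M.D₁ *ᵥ β ≠ z₁ ∘ M.D₁)
    (hz₂ : π₂.IsJeffreys → ∀ lam, M.F z₁ *ᵥ lam ≠ z₂ ∘ M.D₂) :
    -- the likelihoods are the densities of the observations in the autoregressive model
    (∀ (β₁ : Fin p₁ → ℝ) (β₂ : Fin p₂ → ℝ) (ρ s₁ s₂ : ℝ), 0 < s₁ → 0 < s₂ →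
      ∀ (Ω : Type*) [MeasurableSpace Ω] (P : Measure Ω) [IsProbabilityMeasure P]
        (Z₁ Z₂ δ : M.Q → Ω → ℝ), M.IsAutoregressive θ₁ θ₂ β₁ β₂ ρ s₁ s₂ P Z₁ Z₂ δ →
        P.map (fun ω i => Z₁ (M.D₁ i) ω) =
            volume.withDensity (fun y => ENNReal.ofReal (M.likelihood₁ θ₁ β₁ s₁ y)) ∧
          P.map (fun ω => Sum.elim (fun i => Z₁ (M.D₁ i) ω) (fun j => Z₂ (M.D₂ j) ω)) =
            volume.withDensity
              (fun y => ENNReal.ofReal (M.likelihood θ₁ θ₂ β₁ β₂ ρ s₁ s₂ y))) ∧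
    -- the posteriors are well defined
    (Integrable (M.joint₁ θ₁ π₁ z₁) ∧ 0 < ∫ q, M.joint₁ θ₁ π₁ z₁ q) ∧
    (Integrable (M.joint θ₁ θ₂ π₁ π₂ z₁ z₂) ∧ 0 < ∫ q, M.joint θ₁ θ₂ π₁ π₂ z₁ z₂ q) ∧
    -- the joint posterior factorises
    (∀ (β₁ : Fin p₁ → ℝ) (β₂ : Fin p₂ → ℝ) (ρ s₁ s₂ : ℝ),
      M.post θ₁ θ₂ π₁ π₂ z₁ z₂ β₁ (lamVec ρ β₂) s₁ s₂ =
        M.postCoef₁ θ₁ π₁ z₁ s₁ β₁ * M.postCoef₂ θ₁ θ₂ π₁ π₂ z₁ z₂ s₂ (lamVec ρ β₂) *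
          M.postVar₁ θ₁ π₁ z₁ s₁ * M.postVar₂ θ₁ θ₂ π₁ π₂ z₁ z₂ s₂) ∧
    -- the factors are explicit
    (∀ (s₁ : ℝ) (β₁ : Fin p₁ → ℝ), 0 < s₁ →
      M.postCoef₁ θ₁ π₁ z₁ s₁ β₁ =
        gaussianDensity
          (π₁.postCov (M.F₁ M.D₁) (M.R₁ θ₁ M.D₁ M.D₁) s₁ *ᵥ
            π₁.postVec (M.F₁ M.D₁) (M.R₁ θ₁ M.D₁ M.D₁) (z₁ ∘ M.D₁) s₁)
          (π₁.postCov (M.F₁ M.D₁) (M.R₁ θ₁ M.D₁ M.D₁) s₁) β₁) ∧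
    (∀ (s₂ ρ : ℝ) (β₂ : Fin p₂ → ℝ), 0 < s₂ →
      M.postCoef₂ θ₁ θ₂ π₁ π₂ z₁ z₂ s₂ (lamVec ρ β₂) =
        gaussianDensity
          (π₂.postCov (M.F z₁) (M.R₂ θ₂ M.D₂ M.D₂) s₂ *ᵥ
            π₂.postVec (M.F z₁) (M.R₂ θ₂ M.D₂ M.D₂) (z₂ ∘ M.D₂) s₂)
          (π₂.postCov (M.F z₁) (M.R₂ θ₂ M.D₂ M.D₂) s₂) (lamVec ρ β₂)) ∧
    (∀ s₁ : ℝ, M.postVar₁ θ₁ π₁ z₁ s₁ =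
      invGammaDensity (π₁.postShape (Fin n₁))
        (π₁.postQ (M.F₁ M.D₁) (M.R₁ θ₁ M.D₁ M.D₁) (z₁ ∘ M.D₁) / 2) s₁) ∧
    (∀ s₂ : ℝ, M.postVar₂ θ₁ θ₂ π₁ π₂ z₁ z₂ s₂ =
      invGammaDensity (π₂.postShape (Fin n₂))
        (π₂.postQ (M.F z₁) (M.R₂ θ₂ M.D₂ M.D₂) (z₂ ∘ M.D₂) / 2) s₂) := by
  obtain ⟨C₁, m₁, B₁, hC₁, hB₁, hcov₁, hmean₁, hlev₁⟩ :=
    LevelPrior.exists_likelihood_mul_prior_eq hπ₁ hR₁ hF₁ hz₁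
  obtain ⟨C₂, m₂, B₂, hC₂, hB₂, hcov₂, hmean₂, hlev₂⟩ :=
    LevelPrior.exists_likelihood_mul_prior_eq hπ₂ hR₂ hF hz₂
  have ha₁ := LevelPrior.postShape_pos hπ₁ hF₁ hz₁
  have ha₂ := LevelPrior.postShape_pos hπ₂ hF hz₂
  have hQ₁ := half_pos (LevelPrior.postQ_pos hπ₁ hR₁ hF₁ hz₁)
  have hQ₂ := half_pos (LevelPrior.postQ_pos hπ₂ hR₂ hF hz₂)
  -- From here on only the positivity of the shapes and scales matters.
  generalize π₁.postShape (Fin n₁) = a₁ at *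
  generalize π₂.postShape (Fin n₂) = a₂ at *
  generalize π₁.postQ (M.F₁ M.D₁) (M.R₁ θ₁ M.D₁ M.D₁) (z₁ ∘ M.D₁) / 2 = Q₁ at *
  generalize π₂.postQ (M.F z₁) (M.R₂ θ₂ M.D₂ M.D₂) (z₂ ∘ M.D₂) / 2 = Q₂ at *
  have hjoint₁ : M.joint₁ θ₁ π₁ z₁ = fun q => C₁ * normalInvGammaDensity m₁ B₁ a₁ Q₁ q :=
    funext fun q => hlev₁ q.1 q.2
  have hjoint : M.joint θ₁ θ₂ π₁ π₂ z₁ z₂ = fun q => (C₁ * C₂) *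
      (normalInvGammaDensity m₁ B₁ a₁ Q₁ (q.1, q.2.2.1) *
        normalInvGammaDensity m₂ B₂ a₂ Q₂ (q.2.1, q.2.2.2)) := by
    funext ⟨β₁, lam, s₁, s₂⟩
    simp only [TwoLevelModel.joint]
    -- The likelihood splits only for positive variances; elsewhere the prior vanishes and both
    -- sides are zero.
    rcases le_or_gt s₁ 0 with hs₁ | hs₁
    · simp [LevelPrior.varDensity_of_nonpos _ hs₁, normalInvGammaDensity_of_nonpos hs₁]
    rcases le_or_gt s₂ 0 with hs₂ | hs₂
    · simp [LevelPrior.varDensity_of_nonpos _ hs₂, normalInvGammaDensity_of_nonpos hs₂]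
    rw [M.likelihood_eq_mul hR₁ hR₂ hs₁ hs₂, mul_mul_mul_comm, hlev₂, TwoLevelModel.likelihood₁,
      hlev₁]
    ring
  have hint₁ := integrable_normalInvGammaDensity m₁ hB₁ ha₁ hQ₁
  have hint₂ := integrable_normalInvGammaDensity m₂ hB₂ ha₂ hQ₂
  have hone₁ := integral_normalInvGammaDensity m₁ hB₁ ha₁ hQ₁
  have hone₂ := integral_normalInvGammaDensity m₂ hB₂ ha₂ hQ₂
  have hnorm₁ : ∫ q, M.joint₁ θ₁ π₁ z₁ q = C₁ := by
    rw [hjoint₁, integral_const_mul, hone₁, mul_one]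
  have hprod := hint₁.mul_prod hint₂
  have hshuffle := measurePreserving_prod_shuffle (α := Fin p₁ → ℝ) (β := Unit ⊕ Fin p₂ → ℝ)
    (γ := ℝ) (δ := ℝ)
  have hnorm : ∫ q, M.joint θ₁ θ₂ π₁ π₂ z₁ z₂ q = C₁ * C₂ := by
    have h : ∫ q : ((Fin p₁ → ℝ) × ℝ) × ((Unit ⊕ Fin p₂ → ℝ) × ℝ),
        normalInvGammaDensity m₁ B₁ a₁ Q₁ q.1 * normalInvGammaDensity m₂ B₂ a₂ Q₂ q.2 = 1 := by
      rw [Measure.volume_eq_prod, integral_prod_mul, hone₁, hone₂, one_mul]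
    rw [← hshuffle.map_eq, integral_map hshuffle.aemeasurable
      (by rw [hshuffle.map_eq]; exact hprod.aestronglyMeasurable)] at h
    rw [hjoint, integral_const_mul, h, mul_one]
  have hpost₁ : ∀ β₁ s₁, M.post₁ θ₁ π₁ z₁ β₁ s₁ = normalInvGammaDensity m₁ B₁ a₁ Q₁ (β₁, s₁) := by
    intro β₁ s₁
    rw [TwoLevelModel.post₁, hnorm₁, hjoint₁, mul_div_cancel_left₀ _ hC₁.ne']
  have hpost : ∀ β₁ lam s₁ s₂, M.post θ₁ θ₂ π₁ π₂ z₁ z₂ β₁ lam s₁ s₂ =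
      normalInvGammaDensity m₁ B₁ a₁ Q₁ (β₁, s₁) *
        normalInvGammaDensity m₂ B₂ a₂ Q₂ (lam, s₂) := by
    intro β₁ lam s₁ s₂
    rw [TwoLevelModel.post, hnorm, hjoint, mul_div_cancel_left₀ _ (mul_pos hC₁ hC₂).ne']
  have hvar₁ : ∀ s₁, M.postVar₁ θ₁ π₁ z₁ s₁ = invGammaDensity a₁ Q₁ s₁ := by
    intro s₁
    simp_rw [TwoLevelModel.postVar₁, hpost₁]
    exact integral_normalInvGammaDensity_left m₁ hB₁ _ _ _
  have hpost₂ : ∀ lam s₂, M.post₂ θ₁ θ₂ π₁ π₂ z₁ z₂ lam s₂ =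
      normalInvGammaDensity m₂ B₂ a₂ Q₂ (lam, s₂) := by
    intro lam s₂
    simp_rw [TwoLevelModel.post₂, hpost, integral_mul_const]
    rw [hone₁, one_mul]
  have hvar₂ : ∀ s₂, M.postVar₂ θ₁ θ₂ π₁ π₂ z₁ z₂ s₂ = invGammaDensity a₂ Q₂ s₂ := by
    intro s₂
    simp_rw [TwoLevelModel.postVar₂, hpost₂]
    exact integral_normalInvGammaDensity_left m₂ hB₂ _ _ _
  have hcoef₁ : ∀ s₁ β₁, 0 < s₁ →
      M.postCoef₁ θ₁ π₁ z₁ s₁ β₁ = gaussianDensity m₁ (s₁ • B₁) β₁ := by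
    intro s₁ β₁ hs₁
    rw [TwoLevelModel.postCoef₁, hvar₁, hpost₁, normalInvGammaDensity,
      mul_div_cancel_right₀ _ (invGammaDensity_pos ha₁ hQ₁ hs₁).ne']
  have hcoef₂ : ∀ s₂ lam, 0 < s₂ →
      M.postCoef₂ θ₁ θ₂ π₁ π₂ z₁ z₂ s₂ lam = gaussianDensity m₂ (s₂ • B₂) lam := by
    intro s₂ lam hs₂
    rw [TwoLevelModel.postCoef₂, hvar₂, hpost₂, normalInvGammaDensity,
      mul_div_cancel_right₀ _ (invGammaDensity_pos ha₂ hQ₂ hs₂).ne']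
  refine ⟨fun β₁ β₂ ρ s₁ s₂ hs₁ hs₂ Ω _ P _ Z₁ Z₂ δ h =>
      ⟨h.map_level₁_eq_withDensity hR₁ hs₁, h.map_obs_eq_withDensity hR₁ hR₂ hs₁ hs₂⟩,
    ⟨hjoint₁ ▸ hint₁.const_mul C₁, hnorm₁ ▸ hC₁⟩, ⟨?_, hnorm ▸ mul_pos hC₁ hC₂⟩, ?_, ?_, ?_,
    hvar₁, hvar₂⟩
  · rw [hjoint]
    exact (hshuffle.integrable_comp_of_integrable hprod).const_mul (C₁ * C₂)
  · intro β₁ β₂ ρ s₁ s₂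
    rw [hpost, hvar₁, hvar₂]
    -- At a nonpositive variance the conditional density is a quotient by zero, but it is multiplied
    -- by a vanishing marginal, and the posterior on the left vanishes too.
    rcases le_or_gt s₁ 0 with hs₁ | hs₁
    · simp [invGammaDensity_of_nonpos hs₁, normalInvGammaDensity_of_nonpos hs₁]
    rcases le_or_gt s₂ 0 with hs₂ | hs₂
    · simp [invGammaDensity_of_nonpos hs₂, normalInvGammaDensity_of_nonpos hs₂]
    rw [hcoef₁ _ _ hs₁, hcoef₂ _ _ hs₂]
    simp only [normalInvGammaDensity]
    ring
  · intro s₁ β₁ hs₁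
    rw [hcoef₁ _ _ hs₁, hmean₁ _ hs₁, hcov₁ _ hs₁]
  · intro s₂ ρ β₂ hs₂
    rw [hcoef₂ _ _ hs₂, hmean₂ _ hs₂, hcov₂ _ hs₂]
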